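/- Realize the algebra $\mathbb H_{\mathbb C}=\mathbb C\otimes\mathbb H$ of biquaternions as the complex $2\times2$ matrices $Z=\begin{pmatrix}z_{11}&z_{12}\\z_{21}&z_{22}\end{pmatrix}$, with $N(Z)=\det Z$; let $\mathbb H\subset\mathbb H_{\mathbb C}$ be the real quaternions, $S^3=\{X\in\mathbb H: N(X)=1\}$ the unit sphere, and $dS$ its Euclidean volume element. For $l\in\{0,\frac12,1,\dots\}$ and $m,n\in\{-l,-l+1,\dots,l\}$ put $$t^l_{n\,m}(Z)=\frac1{2\pi i}\oint (sz_{11}+z_{21})^{l-m}(sz_{12}+z_{22})^{l+m}s^{-l+n}\,\frac{ds}{s},$$ the integral being over a circle around $0$. As spaces of functions on the invertible elements of $\mathbb H_{\mathbb C}$, let $$\mathcal{BH}^+=\mathrm{span}_{\mathbb C}\{N(Z)^k\,t^l_{n\,m}(Z):0\le k\le1\},\qquad \mathcal{BH}^-=\mathrm{span}_{\mathbb C}\{N(Z)^k\,t^l_{n\,m}(Z):-1\le 2l+k\le0\}$$ ($k\in\mathbb Z$), and let $\mathcal I'_0=\mathbb C$ be the constants, contained in both. The Lie algebra $\mathfrak{gl}(2,\mathbb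 H_{\mathbb C})$ acts by $\rho'$, the derivative of $(\rho'(h)f)(Z)=f\big((aZ+b)(cZ+d)^{-1}\big)$, $h^{-1}=\begin{pmatrix}a&b\\c&d\end{pmatrix}$; both $\mathcal{BH}^\pm$ are invariant. Let $$\mathfrak u(2,2)=\Big\{\begin{pmatrix}A&B\\B^*&D\end{pmatrix}: A,B,D\in\mathbb H_{\mathbb C},\ A=-A^*,\ D=-D^*\Big\}.$$ A Hermitian form $(\cdot,\cdot)$ on a space with an action $\alpha$ of $\mathfrak u(2,2)$ is called invariant if $(\alpha(X)f,g)+(f,\alpha(X)g)=0$ for all $X\in\mathfrak u(2,2)$ and all $f,g$. Put $\phi^{(1)}_{l,m,n}(Z)=t^l_{n\,m}(Z)$ and $\tilde\phi^{(1)}_{l,m,n}(Z)=t^l_{m\,n}(Z^{-1})$ for $l\ge0$, $-l\le m,n\le l$, and $\phi^{(2)}_{l,m,n}(Z)=N(Z)\,t^{l-1}_{n\,m}(Z)$ and $\tilde\phi^{(2)}_{l,m,n}(Z)=N(Z)^{-1}\,t^{l-1}_{m\,n}(Z^{-1})$ for $l\ge1$, $-l+1\le m,n\le l-1$. **Theorem.**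 (a) There is an invariant indefinite Hermitian form on $\mathcal{BH}^+$ that is given on the functions $\phi^{(1)}_{l,m,n}$, $\phi^{(2)}_{l,m,n}$, which span $\mathcal{BH}^+$, by $$\big(\phi^{(1)}_{l,m,n},\phi^{(1)}_{l',m',n'}\big)=\frac{2l(2l+1)}{2\pi^2}\int_{S^3}\phi^{(1)}_{l,m,n}(X)\,\overline{\phi^{(1)}_{l',m',n'}(X)}\,dS,$$ $$\big(\phi^{(2)}_{l,m,n},\phi^{(2)}_{l',m',n'}\big)=-\frac{2l(2l-1)}{2\pi^2}\int_{S^3}\phi^{(2)}_{l,m,n}(X)\,\overline{\phi^{(2)}_{l',m',n'}(X)}\,dS,$$ $$\big(\phi^{(\alpha)}_{l,m,n},\phi^{(\alpha')}_{l',m',n'}\big)=0\quad\text{if }\alpha\ne\alpha'.$$ Its kernel is $\mathcal I'_0$, and it descends to an invariant, non-degenerate, indefinite Hermitian form on $\mathcal{BH}^+/\mathcal I'_0$. (b) The same holds for $\mathcal{BH}^-$ and $\mathcal{BH}^- /\mathcal I'_0$, with $\tilde\phi^{(\alpha)}_{l,m,n}$ in place of $\phi^{(\alpha)}_{l,m,n}$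 and the same coefficients. (c) On each of $\mathcal{BH}^+/\mathcal I'_0$ and $\mathcal{BH}^- /\mathcal I'_0$ every invariant Hermitian form is a real multiple of the form of (a), respectively (b). In particular neither quotient has a $\mathfrak u(2,2)$-invariant unitary structure, that is, a positive definite invariant Hermitian form. -/

import Mathlib

open scoped Matrix ComplexConjugate

noncomputable section

namespace QuatBH

/-! ### Biquaternions, functions on the invertible ones, matrix coefficients -/

/-- The algebra of biquaternions, realized as complex `2 × 2` matrices. -/
abbrev HC := Matrix (Fin 2) (Fin 2) ℂ

/-- The invertible biquaternions. -/
abbrev HCx := GL (Fin 2) ℂ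

/-- The complex-valued functions on the invertible biquaternions. -/
abbrev Fn := HCx → ℂ

/-- `gl(2, HC)`: `2 × 2` block matrices with entries in `HC`. -/
abbrev GlAlg := Matrix (Fin 2 ⊕ Fin 2) (Fin 2 ⊕ Fin 2) ℂ

/-- `N(Z) = Z Z⁺`, which is the determinant of the matrix `Z`. -/
def nrm (Z : HCx) : ℂ := (Z : HC).det

/-- The matrix coefficient `t^l_{n m}(Z)` of `SU(2)`, extended to biquaternions. The half-integers
`l, m, n` (with `-l ≤ m, n ≤ l` and `m, n ∈ ℤ + l`) are encoded by the integers
`d = 2l`, `a = l - m`, `b = l - n`, so that `a, b ∈ {0, …, d}` and `l + m = d - a`: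
`t^l_{n m}(Z) = (2πi)⁻¹ ∮ (s z₁₁ + z₂₁)^(l-m) (s z₁₂ + z₂₂)^(l+m) s^(-l+n) ds/s`. -/
def tFun (d : ℕ) (a b : Fin (d + 1)) : Fn := fun Z =>
  (2 * Real.pi * Complex.I)⁻¹ *
    ∮ s in C(0, 1), (s * Z.val 0 0 + Z.val 1 0) ^ (a : ℕ) *
      (s * Z.val 0 1 + Z.val 1 1) ^ (d - (a : ℕ)) * s ^ (-((b : ℕ) : ℤ)) / s

/-- `BH⁺`: the span of the `N(Z)^k t^l_{n m}(Z)` with `0 ≤ k ≤ 1`. -/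
def BHplus : Submodule ℂ Fn :=
  Submodule.span ℂ {f | ∃ (d : ℕ) (a b : Fin (d + 1)) (k : ℤ), 0 ≤ k ∧ k ≤ 1 ∧
    f = fun Z => nrm Z ^ k * tFun d a b Z}

/-- `BH⁻`: the span of the `N(Z)^k t^l_{n m}(Z)` with `-1 ≤ 2l + k ≤ 0`. -/
def BHminus : Submodule ℂ Fn :=
  Submodule.span ℂ {f | ∃ (d : ℕ) (a b : Fin (d + 1)) (k : ℤ), -1 ≤ (d : ℤ) + k ∧ (d : ℤ) + k ≤ 0 ∧
    f = fun Z => nrm Z ^ k * tFun d a b Z}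

/-- `I'_0`: the constant functions. -/
def I0 : Submodule ℂ Fn := Submodule.span ℂ {fun _ => 1}

/-- `φ^{(1)}_{l,m,n}(Z) = t^l_{n m}(Z)`, with `d = 2l`, `a = l - m`, `b = l - n`. -/
def phi1 (d : ℕ) (a b : Fin (d + 1)) : Fn := tFun d a b

/-- `φ^{(2)}_{l,m,n}(Z) = N(Z) t^{l-1}_{n m}(Z)`, for `l ≥ 1`, with
`d = 2(l - 1)`, `a = (l - 1) - m`, `b = (l - 1) - n`; in particular `2l = d + 2`. -/
def phi2 (d : ℕ) (a b : Fin (d + 1)) : Fn := fun Z => nrm Z * tFun d a b Z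

/-- `φ̃^{(1)}_{l,m,n}(Z) = t^l_{m n}(Z⁻¹)`, indexed as `phi1`. -/
def phi1t (d : ℕ) (a b : Fin (d + 1)) : Fn := fun Z => tFun d b a Z⁻¹

/-- `φ̃^{(2)}_{l,m,n}(Z) = N(Z)⁻¹ t^{l-1}_{m n}(Z⁻¹)`, indexed as `phi2`. -/
def phi2t (d : ℕ) (a b : Fin (d + 1)) : Fn := fun Z => (nrm Z)⁻¹ * tFun d b a Z⁻¹

/-! ### The action of `gl(2, HC)` -/

/-- Extension by zero of a function on the invertible matrices. -/
def extZ (f : Fn) (M : HC) : ℂ := Function.extend (fun Z : HCx => (Z : HC)) f 0 M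

/-- The fractional linear transformation `(aZ + b)(cZ + d)⁻¹` for the block matrix
`g = (a b; c d)`. -/
def moebius (g : GlAlg) (Z : HC) : HC :=
  (g.toBlocks₁₁ * Z + g.toBlocks₁₂) * (g.toBlocks₂₁ * Z + g.toBlocks₂₂)⁻¹

/-- The Lie algebra action `ρ'`: the derivative at `t = 0` of `ρ'(exp(tX)) f`, where
`(ρ'(h) f)(Z) = f((aZ + b)(cZ + d)⁻¹)` for `h⁻¹ = (a b; c d)`. For small `t` the point
`(aZ + b)(cZ + d)⁻¹` is defined and invertible, so the values of `extZ f` at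
non-invertible matrices play no role. -/
def rho (X : GlAlg) (f : Fn) : Fn := fun Z =>
  deriv (fun t : ℝ => extZ f (moebius (NormedSpace.exp (-(t • X))) Z.val)) 0

/-- The real form `u(2,2)`: matrices `(A B; B* D)` with `A = -A*` and `D = -D*`. -/
def u22 : Set GlAlg :=
  {X | ∃ A B D : HC, A = -Aᴴ ∧ D = -Dᴴ ∧ X = Matrix.fromBlocks A B Bᴴ D}

/-- `V` is invariant under the action `ρ'` of `gl(2, HC)`. -/
def Stable (V : Submodule ℂ Fn) : Prop := ∀ X : GlAlg, ∀ f ∈ V, rho X f ∈ V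

/-- The action `ρ'` on an invariant subspace. -/
def act {V : Submodule ℂ Fn} (hV : Stable V) (X : GlAlg) (f : V) : V :=
  ⟨rho X f.1, hV X f.1 f.2⟩

theorem eventually_isUnit (X : GlAlg) (Z : HCx) :
    ∀ᶠ t : ℝ in nhds 0, IsUnit (moebius (NormedSpace.exp (-(t • X))) Z.val) := by
  have hexp : Continuous (fun t : ℝ => NormedSpace.exp (-(t • X))) := by
    let _ : SeminormedRing GlAlg := Matrix.linftyOpSemiNormedRing
    let _ : NormedRing GlAlg := Matrix.linftyOpNormedRing
    let _ : NormedAlgebra ℝ GlAlg := Matrix.linftyOpNormedAlgebra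
    let _ : NormedAlgebra ℚ GlAlg := NormedAlgebra.restrictScalars ℚ ℝ GlAlg
    exact NormedSpace.exp_continuous.comp (by fun_prop)
  have hZ : IsUnit (Z.val).det := (Matrix.isUnit_iff_isUnit_det _).1 Z.isUnit
  have h0 : NormedSpace.exp (-((0 : ℝ) • X)) = Matrix.fromBlocks 1 0 0 1 := by
    simp [Matrix.fromBlocks_one]
  let p : ℝ → ℂ := fun t => ((NormedSpace.exp (-(t • X))).toBlocks₁₁ * Z.val +
    (NormedSpace.exp (-(t • X))).toBlocks₁₂).det
  let q : ℝ → ℂ := fun t => ((NormedSpace.exp (-(t • X))).toBlocks₂₁ * Z.val +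
    (NormedSpace.exp (-(t • X))).toBlocks₂₂).det
  have hb : ∀ i j, Continuous fun t : ℝ => NormedSpace.exp (-(t • X)) i j :=
    fun i j => hexp.matrix_elem i j
  have hp : Continuous p := by
    refine Continuous.matrix_det (Continuous.add (Continuous.mul ?_ continuous_const) ?_) <;>
    exact continuous_matrix fun i j => hb _ _
  have hq : Continuous q := by
    refine Continuous.matrix_det (Continuous.add (Continuous.mul ?_ continuous_const) ?_) <;>
    exact continuous_matrix fun i j => hb _ _
  have hp0 : p 0 ≠ 0 := by
    simp only [p, h0, Matrix.toBlocks_fromBlocks₁₁, Matrix.toBlocks_fromBlocks₁₂]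
    simpa using hZ.ne_zero
  have hq0 : q 0 ≠ 0 := by
    simp only [q, h0, Matrix.toBlocks_fromBlocks₂₁, Matrix.toBlocks_fromBlocks₂₂]
    simp
  filter_upwards [hp.continuousAt.eventually_ne hp0, hq.continuousAt.eventually_ne hq0] with t h1 h2
  rw [Matrix.isUnit_iff_isUnit_det, moebius, Matrix.det_mul, Matrix.det_nonsing_inv]
  exact (isUnit_iff_ne_zero.2 h1).mul (IsUnit.ringInverse (isUnit_iff_ne_zero.2 h2))

theorem rho_eq_of_sub_mem (X : GlAlg) (f g : Fn) (h : f - g ∈ I0) : rho X f = rho X g := by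
  obtain ⟨c, hc⟩ := Submodule.mem_span_singleton.1 h
  have hfg : ∀ Z, f Z = g Z + c := fun Z => by
    have := congrFun hc Z
    simp only [Pi.smul_apply, smul_eq_mul, mul_one, Pi.sub_apply] at this
    rw [this]; ring
  funext Z
  unfold rho
  have key : (fun t : ℝ => extZ f (moebius (NormedSpace.exp (-(t • X))) Z.val)) =ᶠ[nhds 0]
      fun t : ℝ => extZ g (moebius (NormedSpace.exp (-(t • X))) Z.val) + c := by
    filter_upwards [eventually_isUnit X Z] with t ht
    obtain ⟨u, hu⟩ := ht
    rw [← hu]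
    have hinj : Function.Injective (fun Z : HCx => (Z : HC)) := fun _ _ h => Units.ext h
    exact (hinj.extend_apply f 0 u).trans
      ((hfg u).trans (congrArg (· + c) (hinj.extend_apply g 0 u).symm))
  rw [key.deriv_eq, deriv_add_const]

/-- The quotient `V / I'_0` (used for subspaces `V` that contain the constants). -/
abbrev Quo (V : Submodule ℂ Fn) := V ⧸ (I0.submoduleOf V)

/-- The action induced by `ρ'` on the quotient `V / I'_0`. -/
def qact {V : Submodule ℂ Fn} (hV : Stable V) (X : GlAlg) : Quo V → Quo V :=
  Quotient.map (act hV X) (fun f g h => by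
    have h' : f.1 - g.1 ∈ I0 := (I0.submoduleOf V).quotientRel_def.1 h
    refine (I0.submoduleOf V).quotientRel_def.2 ?_
    have : act hV X f = act hV X g := Subtype.ext (rho_eq_of_sub_mem X f.1 g.1 h')
    rw [this, sub_self]
    exact Submodule.zero_mem _)

/-! ### Sesquilinear forms -/

/-- Sesquilinear forms, linear in the first and conjugate linear in the second variable. -/
abbrev Sesq (M : Type) [AddCommGroup M] [Module ℂ M] := M →ₗ[ℂ] M →ₗ⋆[ℂ] ℂ

section Forms

variable {M : Type} [AddCommGroup M] [Module ℂ M]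

def IsHerm (B : Sesq M) : Prop := ∀ x y, B y x = conj (B x y)

def IsIndefinite (B : Sesq M) : Prop := (∃ x, 0 < (B x x).re) ∧ ∃ x, (B x x).re < 0

def IsNondeg (B : Sesq M) : Prop := ∀ x, (∀ y, B x y = 0) → x = 0

def IsPosDef (B : Sesq M) : Prop := ∀ x, x ≠ 0 → 0 < (B x x).re

/-- `B` is preserved by the real Lie algebra `u(2,2)` acting on `M` by `α`. -/
def Preserved (α : GlAlg → M → M) (B : Sesq M) : Prop :=
  ∀ X ∈ u22, ∀ x y, B (α X x) y + B x (α X y) = 0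

end Forms

/-! ### Integration over the unit sphere of the quaternions -/

/-- The real quaternion `x⁰e₀ + x¹e₁ + x²e₂ + x³e₃` as a complex matrix. -/
def quat (x : EuclideanSpace ℝ (Fin 4)) : HC :=
  !![(x 0 : ℂ) - Complex.I * x 3, -Complex.I * x 1 - x 2;
     -Complex.I * x 1 + x 2, (x 0 : ℂ) + Complex.I * x 3]

theorem det_quat (x : EuclideanSpace ℝ (Fin 4)) : (quat x).det = ((‖x‖ ^ 2 : ℝ) : ℂ) := by
  rw [EuclideanSpace.norm_sq_eq]
  simp only [quat, Matrix.det_fin_two_of, Fin.sum_univ_four, Real.norm_eq_abs, sq_abs]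
  push_cast
  linear_combination (-(x 3 : ℂ) ^ 2 - (x 1 : ℂ) ^ 2) * Complex.I_sq

/-- A point of the unit sphere `S³` of the quaternions as an invertible biquaternion. -/
def spt (x : Metric.sphere (0 : EuclideanSpace ℝ (Fin 4)) 1) : HCx :=
  Matrix.GeneralLinearGroup.mkOfDetNeZero (quat x.1) (by
    rw [det_quat, mem_sphere_zero_iff_norm.1 x.2]; simp)

/-- `∫_{S³} f(X) conj(g(X)) dS`, where `dS` is the Euclidean volume element of the unit sphere
(of total mass `2π²`). -/
def sphInt (f g : Fn) : ℂ :=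
  ∫ x, f (spt x) * conj (g (spt x)) ∂(MeasureTheory.volume (α := EuclideanSpace ℝ (Fin 4))).toSphere

/-- The functions `e₁`, `e₂` lie in `V` and together span it, and `H` is given on them by the
formulas
`(e₁, e₁') = 2l(2l+1)/(2π²) ∫ e₁ conj(e₁') dS`, `(e₂, e₂') = -2l(2l-1)/(2π²) ∫ e₂ conj(e₂') dS`,
`(e₁, e₂) = (e₂, e₁) = 0`. Here `2l = d` for `e₁` and `2l = d + 2` for `e₂`. -/
def SphereFormula (V : Submodule ℂ Fn) (e₁ e₂ : (d : ℕ) → Fin (d + 1) → Fin (d + 1) → Fn)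
    (H : Sesq V) : Prop :=
  Submodule.span ℂ {f | ∃ (d : ℕ) (a b : Fin (d + 1)), f = e₁ d a b ∨ f = e₂ d a b} = V ∧
  ∃ (h₁ : ∀ d a b, e₁ d a b ∈ V) (h₂ : ∀ d a b, e₂ d a b ∈ V),
    ∀ (d : ℕ) (a b : Fin (d + 1)) (d' : ℕ) (a' b' : Fin (d' + 1)),
      H ⟨e₁ d a b, h₁ d a b⟩ ⟨e₁ d' a' b', h₁ d' a' b'⟩ =
        ((d : ℂ) * (d + 1)) / (2 * Real.pi ^ 2) * sphInt (e₁ d a b) (e₁ d' a' b') ∧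
      H ⟨e₂ d a b, h₂ d a b⟩ ⟨e₂ d' a' b', h₂ d' a' b'⟩ =
        -(((d : ℂ) + 2) * (d + 1)) / (2 * Real.pi ^ 2) * sphInt (e₂ d a b) (e₂ d' a' b') ∧
      H ⟨e₁ d a b, h₁ d a b⟩ ⟨e₂ d' a' b', h₂ d' a' b'⟩ = 0 ∧
      H ⟨e₂ d a b, h₂ d a b⟩ ⟨e₁ d' a' b', h₁ d' a' b'⟩ = 0

end QuatBH

end

open QuatBH

noncomputable section

namespace QuatBH

open MvPolynomial

/-! ### Polynomial model: coordinates and differential operators -/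

/-! Both spaces are copies of one space `bh` of polynomials in the four matrix entries: the matrix
coefficients, which are harmonic (killed by `box`), and their multiples by the determinant `dt`.
Evaluation `ev` realizes `bh` as `BHplus`. Substitution of Z⁻¹, `evInv`, realizes it as `BHminus`,
because Z⁻¹ is the adjugate over N(Z) and passage to the adjugate preserves each `tSpace d`. Through
these maps ρ' becomes the action `op` by polynomial vector fields, for `evInv` after conjugation by
the block matrix (0 1; 1 0), which preserves u(2,2) (`rho_ev`, `rho_evInv`). It remains to study
`op` on `bh`.

The form is `frm`: a weighted Fischer form of f and g minus one of `box f` and `box g`. In a Fischer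
form z_ij and ∂_ij are adjoint up to a shift of the weight, so the fields of left and right
multiplication are adjoint in pairs for every weight. The weight w(n) = n/n! satisfies w(n) = n
w(n+1), which makes ∂_ij adjoint to z_ij E, with E the Euler field. The required partner of ∂_ij is
the field of Z E_ji Z, which is z_ij E - N ∂^#_ij (`cop_eq`); the term in `box` supplies the
difference, because `box` squared is zero on `bh`. This is `frm_pd`, and invariance (`frm_op`)
follows. Moreover `frm f g` is the Fischer form of `f - dt * box f` against g. The Fischer form is
positive away from the constants, so the kernel consists of the constants (`frm_kernel`). The
operator f ↦ f - N box f is 1 on harmonic f and -(d+1) on N times `tSpace d`, whence the two signs.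

The comparison with the sphere goes through the Gaussian integral over the real quaternions. By
integration by parts the Gaussian inner product of harmonic polynomials is the unweighted Fischer
product (`lam_mul_cj`), and polar coordinates turn it into the inner product over S³
(`sphere_inner`) with a factor (d+1)!. Then (d+1)! d/d! = d(d+1) is the coefficient 2l(2l+1).

For uniqueness, pull an invariant form back to `bh` and subtract the real multiple of `frm` that
agrees with it at z_00. The weight of z_00 has multiplicity one, so z_00 lies in the radical of the
difference. The radical is stable under all of gl(2, HC) and contains 1, and these two vectors
generate `bh` (`bh_le_of_stable`), so the difference is zero. A positive definite invariant form
would thus be a real multiple of an indefinite one. -/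

abbrev Pol := MvPolynomial (Fin 2 × Fin 2) ℂ

/-- The coordinate functions `z_ij`. -/
def zz (i j : Fin 2) : Pol := X (i, j)

/-- The partial derivatives. -/
def pd (i j : Fin 2) : Derivation ℂ Pol Pol := pderiv (i, j)

def sgn (i j : Fin 2) : ℂ := if i = j then 1 else -1

/-- The cofactor of `z_ij`. -/
def zd (i j : Fin 2) : Pol := C (sgn i j) * zz (1 - i) (1 - j)

/-- The differential operator `∂^#_ij` dual to the cofactor. -/
def pdd (i j : Fin 2) : Pol →ₗ[ℂ] Pol := sgn i j • (pd (1 - i) (1 - j)).toLinearMap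

def dt : Pol := zz 0 0 * zz 1 1 - zz 0 1 * zz 1 0

def box : Pol →ₗ[ℂ] Pol :=
  (pd 0 0).toLinearMap ∘ₗ (pd 1 1).toLinearMap - (pd 0 1).toLinearMap ∘ₗ (pd 1 0).toLinearMap

/-- The Euler operator. -/
def eul : Derivation ℂ Pol Pol := ∑ i, ∑ j, zz i j • pd i j

/-- The vector field of `Z ↦ E_ik Z`. -/
def lop (i k : Fin 2) : Derivation ℂ Pol Pol := ∑ j, zz k j • pd i j

/-- The vector field of `Z ↦ Z E_kj`. -/
def rop (k j : Fin 2) : Derivation ℂ Pol Pol := ∑ i, zz i k • pd i j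

/-- The vector field of `Z ↦ Z E_ji Z`. -/
def cop (j i : Fin 2) : Derivation ℂ Pol Pol := ∑ k, ∑ l, (zz k j * zz i l) • pd k l

theorem pd_zz (i j k l : Fin 2) : pd i j (zz k l) = if i = k ∧ j = l then 1 else 0 := by
  simp only [pd, zz, pderiv_X, Pi.single_apply, Prod.mk.injEq]
  congr 1
  simp [eq_comm]

theorem pd_comm (i j k l : Fin 2) (f : Pol) : pd i j (pd k l f) = pd k l (pd i j f) := by
  have h : ⁅pd i j, pd k l⁆ = 0 := by
    refine MvPolynomial.derivation_ext fun x => ?_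
    obtain ⟨a, b⟩ := x
    have := pd_zz
    simp only [zz] at this
    simp only [Derivation.commutator_apply, this, Derivation.zero_apply]
    split_ifs <;> simp
  have := congrArg (fun D => D f) h
  simp only [Derivation.commutator_apply, Derivation.zero_apply] at this
  exact sub_eq_zero.1 this

theorem pdd_apply (i j : Fin 2) (f : Pol) : pdd i j f = C (sgn i j) * pd (1 - i) (1 - j) f := by
  simp [pdd, smul_eq_C_mul]

theorem box_apply (f : Pol) : box f = pd 0 0 (pd 1 1 f) - pd 0 1 (pd 1 0 f) := rfl

theorem eul_apply (f : Pol) : eul f =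
    zz 0 0 * pd 0 0 f + zz 0 1 * pd 0 1 f + zz 1 0 * pd 1 0 f + zz 1 1 * pd 1 1 f := by
  simp [eul, Fin.sum_univ_two]; ring

theorem lop_apply (i k : Fin 2) (f : Pol) : lop i k f = zz k 0 * pd i 0 f + zz k 1 * pd i 1 f := by
  simp [lop, Fin.sum_univ_two]

theorem rop_apply (k j : Fin 2) (f : Pol) : rop k j f = zz 0 k * pd 0 j f + zz 1 k * pd 1 j f := by
  simp [rop, Fin.sum_univ_two]

theorem cop_apply (j i : Fin 2) (f : Pol) : cop j i f = zz 0 j * zz i 0 * pd 0 0 f +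
    zz 0 j * zz i 1 * pd 0 1 f + zz 1 j * zz i 0 * pd 1 0 f + zz 1 j * zz i 1 * pd 1 1 f := by
  simp [cop, Fin.sum_univ_two]; ring

theorem sgn_zz : sgn 0 0 = 1 := rfl
theorem sgn_zo : sgn 0 1 = -1 := rfl
theorem sgn_oz : sgn 1 0 = -1 := rfl
theorem sgn_oo : sgn 1 1 = 1 := rfl

theorem pd_mul (i j : Fin 2) (f g : Pol) : pd i j (f * g) = f * pd i j g + g * pd i j f := by
  simp [Derivation.leibniz]

theorem pd_C (i j : Fin 2) (c : ℂ) : pd i j (C c) = 0 := by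
  simp [pd]

/-- The second-order derivatives, brought into a fixed order. -/
theorem pd_sort (f : Pol) : pd 1 1 (pd 0 0 f) = pd 0 0 (pd 1 1 f) ∧
    pd 1 1 (pd 0 1 f) = pd 0 1 (pd 1 1 f) ∧ pd 1 1 (pd 1 0 f) = pd 1 0 (pd 1 1 f) ∧
    pd 1 0 (pd 0 1 f) = pd 0 1 (pd 1 0 f) ∧ pd 1 0 (pd 0 0 f) = pd 0 0 (pd 1 0 f) ∧
    pd 0 1 (pd 0 0 f) = pd 0 0 (pd 0 1 f) :=
  ⟨pd_comm .., pd_comm .., pd_comm .., pd_comm .., pd_comm .., pd_comm ..⟩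

/-- The coefficient of ∂_kl in the difference z_ij E - (Z E_ji Z)·∂ is z_ij z_kl - z_kj z_il. It
vanishes if k = i or l = j, and is ± the determinant otherwise. -/
theorem cop_eq (j i : Fin 2) (f : Pol) : cop j i f = zz i j * eul f - dt * pdd i j f := by
  fin_cases i <;> fin_cases j <;>
  simp [cop_apply, eul_apply, dt, pdd_apply, sgn] <;> ring

theorem box_zz (i j : Fin 2) (f : Pol) : box (zz i j * f) = zz i j * box f + pdd i j f := by
  fin_cases i <;> fin_cases j <;>
  simp [box_apply, pdd_apply, pd_zz, sgn] <;> ring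

theorem box_eul (f : Pol) : box (eul f) = eul (box f) + 2 * box f := by
  simp [box_apply, eul_apply, pd_zz, pd_sort]; ring

theorem pd_eul (i j : Fin 2) (f : Pol) : pd i j (eul f) = eul (pd i j f) + pd i j f := by
  fin_cases i <;> fin_cases j <;>
  simp [eul_apply, pd_zz, pd_sort] <;> ring

theorem pdd_eul (i j : Fin 2) (f : Pol) : pdd i j (eul f) = eul (pdd i j f) + pdd i j f := by
  simp only [pdd_apply, ← smul_eq_C_mul, pd_eul, Derivation.map_smul, smul_add]

theorem pd_dt (i j : Fin 2) : pd i j dt = zd i j := by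
  fin_cases i <;> fin_cases j <;> simp [dt, zd, pd_zz, sgn]

theorem pdd_dt (i j : Fin 2) (f : Pol) : pdd i j (dt * f) = dt * pdd i j f + zz i j * f := by
  fin_cases i <;> fin_cases j <;> simp [pdd_apply, dt, pd_zz, sgn] <;> ring

/-- This is the sl(2) commutator of `box` and multiplication by `dt`; the constant 2 is half the
number of variables. -/
theorem box_dt (f : Pol) : box (dt * f) = dt * box f + eul f + 2 * f := by
  simp [box_apply, dt, eul_apply, pd_zz]; ring

theorem eul_dt (f : Pol) : eul (dt * f) = dt * eul f + 2 * (dt * f) := by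
  simp [dt, eul_apply, pd_zz]; ring

theorem box_pd (i j : Fin 2) (f : Pol) : box (pd i j f) = pd i j (box f) := by
  simp only [box_apply, map_sub]
  rw [pd_comm 1 1, pd_comm 0 0, pd_comm 1 0, pd_comm 0 1]

/-- The determinant is multiplicative, so E_ik acts on it by its trace. In particular the
off-diagonal fields commute with `dt`. -/
theorem lop_dt (i k : Fin 2) (f : Pol) :
    lop i k (dt * f) = dt * lop i k f + if i = k then dt * f else 0 := by
  fin_cases i <;> fin_cases k <;> simp [lop_apply, dt, pd_zz] <;> first | ring1 | (ring_nf; simp)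

theorem rop_dt (i k : Fin 2) (f : Pol) :
    rop i k (dt * f) = dt * rop i k f + if i = k then dt * f else 0 := by
  fin_cases i <;> fin_cases k <;> simp [rop_apply, dt, pd_zz] <;> first | ring1 | (ring_nf; simp)

theorem box_lop (i k : Fin 2) (f : Pol) :
    box (lop i k f) = lop i k (box f) + if i = k then box f else 0 := by
  fin_cases i <;> fin_cases k <;> simp [lop_apply, box_apply, pd_zz, pd_sort] <;> ring

theorem box_rop (i k : Fin 2) (f : Pol) :
    box (rop i k f) = rop i k (box f) + if i = k then box f else 0 := by
  fin_cases i <;> fin_cases k <;> simp [rop_apply, box_apply, pd_zz, pd_sort] <;> ring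

theorem eul_eq_lop (f : Pol) : eul f = lop 0 0 f + lop 1 1 f := by
  simp [eul_apply, lop_apply]; ring

theorem sum_zz_pdd_pd (f : Pol) : ∑ i, ∑ j, pdd i j (pd i j f) = 2 * box f := by
  simp [Fin.sum_univ_two, pdd_apply, sgn, box_apply, pd_sort]; ring

/-! ### The matrix coefficients as polynomials -/

/-- The action of a derivation on the coefficients of a polynomial. -/
def liftD (D : Derivation ℂ Pol Pol) : Derivation ℂ (Polynomial Pol) (Polynomial Pol) :=
  (PolynomialModule.equivPolynomialSelf (R := Pol)).toLinearMap.compDer D.mapCoeffs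

theorem coeff_liftD (D : Derivation ℂ Pol Pol) (p : Polynomial Pol) (n : ℕ) :
    (liftD D p).coeff n = D (p.coeff n) := rfl

theorem liftD_X (D : Derivation ℂ Pol Pol) : liftD D Polynomial.X = 0 := by
  ext1 n
  rw [coeff_liftD, Polynomial.coeff_X]
  split_ifs <;> simp

theorem liftD_C (D : Derivation ℂ Pol Pol) (x : Pol) :
    liftD D (Polynomial.C x) = Polynomial.C (D x) := by
  ext1 n
  rw [coeff_liftD, Polynomial.coeff_C, Polynomial.coeff_C]
  split_ifs <;> simp

def colF : Polynomial Pol := Polynomial.X * Polynomial.C (zz 0 0) + Polynomial.C (zz 1 0)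

def colG : Polynomial Pol := Polynomial.X * Polynomial.C (zz 0 1) + Polynomial.C (zz 1 1)

/-- The generating polynomial of the matrix coefficients. -/
def gen (a c : ℕ) : Polynomial Pol := colF ^ a * colG ^ c

/-- The matrix coefficient with `a = l - m`, `c = l + m`, `b = l - n`. -/
def tP (a c b : ℕ) : Pol := (gen a c).coeff b

theorem colF_mul_gen (a c : ℕ) : colF * gen a c = gen (a + 1) c := by
  rw [gen, gen, pow_succ', mul_assoc]

theorem colG_mul_gen (a c : ℕ) : colG * gen a c = gen a (c + 1) := by
  rw [gen, gen, pow_succ', mul_left_comm]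

/-- The factor s or 1 with which z_ij enters the linear form s z_0j + z_1j of column j. -/
def shift (i : Fin 2) : Polynomial Pol := if i = 0 then Polynomial.X else 1

theorem liftD_colF (i j : Fin 2) : liftD (pd i j) colF = if j = 0 then shift i else 0 := by
  fin_cases i <;> fin_cases j <;> simp [colF, liftD_X, liftD_C, pd_zz, shift]

theorem liftD_colG (i j : Fin 2) : liftD (pd i j) colG = if j = 1 then shift i else 0 := by
  fin_cases i <;> fin_cases j <;> simp [colG, liftD_X, liftD_C, pd_zz, shift]

theorem liftD_gen_zero (i : Fin 2) (a c : ℕ) :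
    liftD (pd i 0) (gen a c) = (a : Polynomial Pol) * (shift i * gen (a - 1) c) := by
  simp [gen, Derivation.leibniz, Derivation.leibniz_pow, liftD_colF, liftD_colG]
  ring

theorem liftD_gen_one (i : Fin 2) (a c : ℕ) :
    liftD (pd i 1) (gen a c) = (c : Polynomial Pol) * (shift i * gen a (c - 1)) := by
  simp [gen, Derivation.leibniz, Derivation.leibniz_pow, liftD_colF, liftD_colG]
  ring

theorem natCast_coeff_mul (n b : ℕ) (p : Polynomial Pol) :
    ((n : Polynomial Pol) * p).coeff b = (n : ℂ) • p.coeff b := by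
  rw [← Polynomial.C_eq_natCast, Polynomial.coeff_C_mul, smul_eq_C_mul]
  simp

theorem pd_tP_zero (i : Fin 2) (a c b : ℕ) :
    pd i 0 (tP a c b) = (a : ℂ) • (shift i * gen (a - 1) c).coeff b := by
  rw [tP, ← coeff_liftD, liftD_gen_zero, natCast_coeff_mul]

theorem pd_tP_one (i : Fin 2) (a c b : ℕ) :
    pd i 1 (tP a c b) = (c : ℂ) • (shift i * gen a (c - 1)).coeff b := by
  rw [tP, ← coeff_liftD, liftD_gen_one, natCast_coeff_mul]

/-! ### Spans of matrix coefficients of fixed degree, and their harmonicity -/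

/-- The space spanned by the matrix coefficients of degree `d`. -/
def tSpace (d : ℕ) : Submodule ℂ Pol :=
  Submodule.span ℂ {f | ∃ a c b, a + c = d ∧ f = tP a c b}

theorem tP_mem (a c b : ℕ) : tP a c b ∈ tSpace (a + c) :=
  Submodule.subset_span ⟨a, c, b, rfl, rfl⟩

theorem tP_mem' {d a c : ℕ} (h : a + c = d) (b : ℕ) : tP a c b ∈ tSpace d :=
  Submodule.subset_span ⟨a, c, b, h, rfl⟩

theorem coeff_shift_mem {d a c : ℕ} (h : a + c = d) (i : Fin 2) (b : ℕ) :
    (shift i * gen a c).coeff b ∈ tSpace d := by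
  fin_cases i
  · cases b with
    | zero => simp [shift]
    | succ b => simpa [shift, tP] using tP_mem' h b
  · simpa [shift, tP] using tP_mem' h b

theorem tSpace_induction {d : ℕ} {p : Pol → Prop} (h0 : p 0) (ha : ∀ f g, p f → p g → p (f + g))
    (hs : ∀ (c : ℂ) f, p f → p (c • f)) (h : ∀ a c b, a + c = d → p (tP a c b))
    {f : Pol} (hf : f ∈ tSpace d) : p f :=
  Submodule.span_induction (p := fun f _ => p f) (by rintro _ ⟨a, c, b, hd, rfl⟩; exact h a c b hd)
    h0 (fun f g _ _ => ha f g) (fun c f _ => hs c f) hf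

theorem map_mem_of_tP {d : ℕ} (φ : Pol →ₗ[ℂ] Pol) (S : Submodule ℂ Pol)
    (h : ∀ a c b, a + c = d → φ (tP a c b) ∈ S) {f : Pol} (hf : f ∈ tSpace d) : φ f ∈ S := by
  have : tSpace d ≤ S.comap φ := Submodule.span_le.2 (by
    rintro _ ⟨a, c, b, hd, rfl⟩; exact h a c b hd)
  exact this hf

theorem pd_mem {d : ℕ} {f : Pol} (hf : f ∈ tSpace d) (i j : Fin 2) : pd i j f ∈ tSpace (d - 1) := by
  refine map_mem_of_tP (pd i j).toLinearMap _ (fun a c b h => ?_) hf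
  change pd i j (tP a c b) ∈ _
  fin_cases j
  · rcases Nat.eq_zero_or_pos a with rfl | ha
    · simp [pd_tP_zero]
    · simp only [Fin.zero_eta, pd_tP_zero]
      exact Submodule.smul_mem _ _ (coeff_shift_mem (by omega) _ _)
  · rcases Nat.eq_zero_or_pos c with rfl | ha
    · simp [pd_tP_one]
    · simp only [Fin.mk_one, pd_tP_one]
      exact Submodule.smul_mem _ _ (coeff_shift_mem (by omega) _ _)

/-- Each derivative in row 0 contributes a factor s and each in row 1 a factor 1, so ∂_00∂_11 and
∂_01∂_10 have the same effect on the generating polynomial. -/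
theorem box_tP (a c b : ℕ) : box (tP a c b) = 0 := by
  have h1 : pd 1 1 (tP a c b) = (c : ℂ) • tP a (c - 1) b := by
    rw [pd_tP_one]; simp [shift, tP]
  have h2 : pd 1 0 (tP a c b) = (a : ℂ) • tP (a - 1) c b := by
    rw [pd_tP_zero]; simp [shift, tP]
  rw [box_apply, h1, h2, Derivation.map_smul, Derivation.map_smul, pd_tP_zero, pd_tP_one,
    smul_comm, sub_self]

theorem box_eq_zero {d : ℕ} {f : Pol} (hf : f ∈ tSpace d) : box f = 0 :=
  (Submodule.mem_bot ℂ).1 (map_mem_of_tP box ⊥ (fun a c b _ => by rw [box_tP]; exact zero_mem _) hf)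

/-! #### The action of the row and column operators -/

theorem rop_zero_zero_tP (a c b : ℕ) : rop 0 0 (tP a c b) = (a : ℂ) • tP a c b := by
  have : rop 0 0 (tP a c b) = ((a : Polynomial Pol) * (colF * gen (a - 1) c)).coeff b := by
    rw [rop_apply, tP, ← coeff_liftD, ← coeff_liftD, ← Polynomial.coeff_C_mul,
      ← Polynomial.coeff_C_mul, ← Polynomial.coeff_add, liftD_gen_zero, liftD_gen_zero]
    congr 1
    simp [shift, colF]; ring
  rw [this, natCast_coeff_mul]
  cases a with
  | zero => simp
  | succ a => rw [Nat.add_sub_cancel, colF_mul_gen, tP]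

theorem rop_one_zero_tP (a c b : ℕ) : rop 1 0 (tP (a + 1) c b) = ((a : ℂ) + 1) • tP a (c + 1) b := by
  have : rop 1 0 (tP (a + 1) c b) = (((a + 1 : ℕ) : Polynomial Pol) * (gen a (c + 1))).coeff b := by
    rw [rop_apply, tP, ← coeff_liftD, ← coeff_liftD, ← Polynomial.coeff_C_mul,
      ← Polynomial.coeff_C_mul, ← Polynomial.coeff_add, liftD_gen_zero, liftD_gen_zero]
    congr 1
    simp [shift, gen, colG]; ring
  rw [this, natCast_coeff_mul, tP]
  simp

theorem rop_zero_one_tP (a c b : ℕ) : rop 0 1 (tP a (c + 1) b) = ((c : ℂ) + 1) • tP (a + 1) c b := by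
  have : rop 0 1 (tP a (c + 1) b) = (((c + 1 : ℕ) : Polynomial Pol) * (gen (a + 1) c)).coeff b := by
    rw [rop_apply, tP, ← coeff_liftD, ← coeff_liftD, ← Polynomial.coeff_C_mul,
      ← Polynomial.coeff_C_mul, ← Polynomial.coeff_add, liftD_gen_one, liftD_gen_one]
    congr 1
    simp [shift, gen, colF]; ring
  rw [this, natCast_coeff_mul, tP]
  simp

theorem rop_one_one_tP (a c b : ℕ) : rop 1 1 (tP a c b) = (c : ℂ) • tP a c b := by
  have : rop 1 1 (tP a c b) = ((c : Polynomial Pol) * (colG * gen a (c - 1))).coeff b := by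
    rw [rop_apply, tP, ← coeff_liftD, ← coeff_liftD, ← Polynomial.coeff_C_mul,
      ← Polynomial.coeff_C_mul, ← Polynomial.coeff_add, liftD_gen_one, liftD_gen_one]
    congr 1
    simp [shift, colG]; ring
  rw [this, natCast_coeff_mul]
  cases c with
  | zero => simp
  | succ c => rw [Nat.add_sub_cancel, colG_mul_gen, tP]

theorem derivative_gen (a c : ℕ) : Polynomial.derivative (gen a c) =
    (a : Polynomial Pol) * Polynomial.C (zz 0 0) * gen (a - 1) c +
    (c : Polynomial Pol) * Polynomial.C (zz 0 1) * gen a (c - 1) := by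
  simp [gen, Polynomial.derivative_pow, colF, colG]
  ring

/-- Euler's relation: homogenized by a second variable in place of 1, the generating polynomial has
degree a + c, and the right side is its derivative in that variable. -/
theorem degree_gen (a c : ℕ) : ((a + c : ℕ) : Polynomial Pol) * gen a c -
    Polynomial.X * Polynomial.derivative (gen a c) =
    (a : Polynomial Pol) * Polynomial.C (zz 1 0) * gen (a - 1) c +
    (c : Polynomial Pol) * Polynomial.C (zz 1 1) * gen a (c - 1) := by
  rw [derivative_gen]
  have h1 : (a : Polynomial Pol) * gen a c = (a : Polynomial Pol) * (colF * gen (a - 1) c) := by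
    cases a with
    | zero => simp
    | succ a => rw [Nat.add_sub_cancel, colF_mul_gen]
  have h2 : (c : Polynomial Pol) * gen a c = (c : Polynomial Pol) * (colG * gen a (c - 1)) := by
    cases c with
    | zero => simp
    | succ a => rw [Nat.add_sub_cancel, colG_mul_gen]
  push_cast
  rw [add_mul, h1, h2, colF, colG]
  ring

/-- Left multiplication moves the row vector (s, 1) only, so its fields act on the generating
polynomial as first-order operators in s. -/
theorem lop_tP (i k : Fin 2) (a c b : ℕ) : lop i k (tP a c b) =
    (shift i * if k = 0 then Polynomial.derivative (gen a c) else ((a + c : ℕ) : Polynomial Pol) * gen a c -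
    Polynomial.X * Polynomial.derivative (gen a c)).coeff b := by
  rw [lop_apply, tP, ← coeff_liftD, ← coeff_liftD, ← Polynomial.coeff_C_mul,
      ← Polynomial.coeff_C_mul, ← Polynomial.coeff_add, liftD_gen_one, liftD_gen_zero]
  congr 1
  fin_cases k
  · simp [derivative_gen]; ring
  · simp only [Fin.mk_one, one_ne_zero, if_false, degree_gen]; ring

theorem coeff_X_mul_derivative (p : Polynomial Pol) (b : ℕ) :
    (Polynomial.X * Polynomial.derivative p).coeff b = (b : ℂ) • p.coeff b := by
  cases b with
  | zero => simp
  | succ b =>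
    rw [Polynomial.coeff_X_mul, Polynomial.coeff_derivative, smul_eq_C_mul]
    simp [mul_comm]

theorem lop_zero_zero_tP (a c b : ℕ) : lop 0 0 (tP a c b) = (b : ℂ) • tP a c b := by
  rw [lop_tP]; simp only [shift, if_true]; rw [coeff_X_mul_derivative]; rfl

theorem lop_one_one_tP (a c b : ℕ) : lop 1 1 (tP a c b) = ((a : ℂ) + c - b) • tP a c b := by
  rw [lop_tP]
  simp only [shift, one_ne_zero, if_false, one_mul, Polynomial.coeff_sub, coeff_X_mul_derivative,
    natCast_coeff_mul]
  rw [← sub_smul]; simp [tP]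

theorem lop_one_zero_tP (a c b : ℕ) : lop 1 0 (tP a c b) = ((b : ℂ) + 1) • tP a c (b + 1) := by
  rw [lop_tP]
  simp only [shift, one_ne_zero, if_true, if_false, one_mul, Polynomial.coeff_derivative]
  rw [smul_eq_C_mul, mul_comm]; simp [tP]

theorem lop_zero_one_tP_succ (a c b : ℕ) :
    lop 0 1 (tP a c (b + 1)) = ((a : ℂ) + c - b) • tP a c b := by
  rw [lop_tP]
  simp only [shift, one_ne_zero, if_true, if_false, Polynomial.coeff_X_mul, Polynomial.coeff_sub,
    natCast_coeff_mul]
  rw [coeff_X_mul_derivative, ← sub_smul]; simp [tP]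

theorem lop_zero_one_tP_zero (a c : ℕ) : lop 0 1 (tP a c 0) = 0 := by
  rw [lop_tP]; simp [shift]

theorem eul_tP (a c b : ℕ) : eul (tP a c b) = ((a : ℂ) + c) • tP a c b := by
  rw [eul_eq_lop, lop_zero_zero_tP, lop_one_one_tP, ← add_smul]; congr 1; ring

theorem eul_eq {d : ℕ} {f : Pol} (hf : f ∈ tSpace d) : eul f = (d : ℂ) • f :=
  tSpace_induction (p := fun f => eul f = (d : ℂ) • f) (by simp)
    (fun f g hf hg => by rw [map_add, hf, hg, smul_add])
    (fun c f hf => by rw [Derivation.map_smul, hf, smul_comm])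
    (fun a c b h => by rw [eul_tP, ← h]; push_cast; rfl) hf

theorem lop_mem {d : ℕ} {f : Pol} (hf : f ∈ tSpace d) (i k : Fin 2) : lop i k f ∈ tSpace d := by
  refine map_mem_of_tP (lop i k).toLinearMap _ (fun a c b h => ?_) hf
  change lop i k (tP a c b) ∈ _
  fin_cases i <;> fin_cases k
  · simp only [Fin.zero_eta, lop_zero_zero_tP]; exact Submodule.smul_mem _ _ (tP_mem' h b)
  · cases b with
    | zero => simp [lop_zero_one_tP_zero]
    | succ b =>
      simp only [Fin.zero_eta, Fin.mk_one, lop_zero_one_tP_succ]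
      exact Submodule.smul_mem _ _ (tP_mem' h b)
  · simp only [Fin.zero_eta, Fin.mk_one, lop_one_zero_tP]; exact Submodule.smul_mem _ _ (tP_mem' h _)
  · simp only [Fin.mk_one, lop_one_one_tP]; exact Submodule.smul_mem _ _ (tP_mem' h _)

theorem rop_mem {d : ℕ} {f : Pol} (hf : f ∈ tSpace d) (k j : Fin 2) : rop k j f ∈ tSpace d := by
  refine map_mem_of_tP (rop k j).toLinearMap _ (fun a c b h => ?_) hf
  change rop k j (tP a c b) ∈ _
  fin_cases k <;> fin_cases j
  · simp only [Fin.zero_eta, rop_zero_zero_tP]; exact Submodule.smul_mem _ _ (tP_mem' h b)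
  · cases c with
    | zero => simp [rop_apply, pd_tP_one]
    | succ c =>
      simp only [Fin.zero_eta, Fin.mk_one, rop_zero_one_tP]
      exact Submodule.smul_mem _ _ (tP_mem' (by omega) b)
  · cases a with
    | zero => simp [rop_apply, pd_tP_zero]
    | succ a =>
      simp only [Fin.zero_eta, Fin.mk_one, rop_one_zero_tP]
      exact Submodule.smul_mem _ _ (tP_mem' (by omega) b)
  · simp only [Fin.mk_one, rop_one_one_tP]; exact Submodule.smul_mem _ _ (tP_mem' h _)

/-! #### Multiplication by coordinates -/

/-- Eliminating s between the two column forms leaves the determinant. This is where `dt` enters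
products of coordinates and matrix coefficients. -/
theorem colF_colG : colF * Polynomial.C (zz 0 1) - Polynomial.C (zz 0 0) * colG =
    -Polynomial.C dt := by
  simp [colF, colG, dt]; ring

theorem derivative_gen_succ_left (a c : ℕ) : Polynomial.derivative (gen (a + 1) c) =
    ((a + c + 1 : ℕ) : Polynomial Pol) * Polynomial.C (zz 0 0) * gen a c -
    Polynomial.C dt * (c * gen a (c - 1)) := by
  rw [derivative_gen]
  cases c with
  | zero => simp [gen]
  | succ c =>
    simp only [gen, Nat.add_sub_cancel]
    push_cast
    linear_combination ((c : Polynomial Pol) + 1) * colF ^ a * colG ^ c * colF_colG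

theorem derivative_gen_succ_right (a c : ℕ) : Polynomial.derivative (gen a (c + 1)) =
    ((a + c + 1 : ℕ) : Polynomial Pol) * Polynomial.C (zz 0 1) * gen a c +
    Polynomial.C dt * (a * gen (a - 1) c) := by
  rw [derivative_gen]
  cases a with
  | zero => simp [gen]
  | succ a =>
    simp only [gen, Nat.add_sub_cancel]
    push_cast
    linear_combination (-(a : Polynomial Pol) - 1) * colF ^ a * colG ^ c * colF_colG

/-- In each of the four cases the expression is a multiple of a single matrix coefficient of the
next degree, read off from the s-derivative of `gen (a + 1) c` or `gen a (c + 1)`. -/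
theorem mul_tP_mem (i j : Fin 2) (a c b : ℕ) :
    ((a : ℂ) + c + 1) • (zz i j * tP a c b) - dt * pdd i j (tP a c b) ∈ tSpace (a + c + 1) := by
  have cast : ∀ p : Pol, ((a : ℂ) + c + 1) • p = ((a + c + 1 : ℕ) : Pol) * p := fun p => by
    rw [smul_eq_C_mul]; simp
  have hcast : ((a + c + 1 : ℕ) : Polynomial Pol) = Polynomial.C ((a + c + 1 : ℕ) : Pol) := by simp
  have hs : ∀ (n : ℕ) (p : Pol), (n : ℂ) • p = (n : Pol) * p := fun n p => by
    rw [smul_eq_C_mul]; simp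
  have gl := derivative_gen_succ_left a c
  have gr := derivative_gen_succ_right a c
  fin_cases i <;> fin_cases j <;>
  simp only [Fin.zero_eta, Fin.mk_one, pdd_apply, sgn_zz, sgn_zo, sgn_oz, sgn_oo, sub_zero,
    sub_self, map_one, one_mul, pd_tP_zero, pd_tP_one, shift, if_true, one_ne_zero, if_false]
  · have : ((a : ℂ) + c + 1) • (zz 0 0 * tP a c b) - dt * (c : ℂ) • (gen a (c - 1)).coeff b =
        ((b : ℂ) + 1) • tP (a + 1) c (b + 1) := by
      rw [← lop_one_zero_tP, lop_tP]
      simp only [shift, one_ne_zero, if_true, if_false, one_mul, gl, Polynomial.coeff_sub,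
        Polynomial.coeff_C_mul, natCast_coeff_mul]
      rw [mul_assoc, natCast_coeff_mul, Polynomial.coeff_C_mul]
      simp [tP]
    rw [this]
    exact Submodule.smul_mem _ _ (tP_mem' (by omega) _)
  · have : ((a : ℂ) + c + 1) • (zz 0 1 * tP a c b) -
        dt * (C (-1) * (a : ℂ) • (gen (a - 1) c).coeff b) = ((b : ℂ) + 1) • tP a (c + 1) (b + 1) := by
      rw [← lop_one_zero_tP, lop_tP]
      simp only [shift, one_ne_zero, if_true, if_false, one_mul, gr, Polynomial.coeff_add,
        Polynomial.coeff_C_mul, natCast_coeff_mul]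
      rw [mul_assoc, natCast_coeff_mul, Polynomial.coeff_C_mul]
      simp [tP]
    rw [this]
    exact Submodule.smul_mem _ _ (tP_mem' (by omega) _)
  · have : ((a : ℂ) + c + 1) • (zz 1 0 * tP a c b) -
        dt * (C (-1) * (c : ℂ) • (Polynomial.X * gen a (c - 1)).coeff b) =
        ((a : ℂ) + c + 1 - b) • tP (a + 1) c b := by
      have e := lop_one_one_tP (a + 1) c b
      rw [lop_tP] at e
      simp only [shift, one_ne_zero, if_false, one_mul, gl] at e
      have e2 : ((a : ℂ) + c + 1 - b) = (((a + 1 : ℕ) : ℂ) + c - b) := by push_cast; ring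
      rw [e2, ← e, cast, hs, tP]
      have e3 : ((a + 1 + c : ℕ) : Polynomial Pol) * gen (a + 1) c - Polynomial.X *
          (((a + c + 1 : ℕ) : Polynomial Pol) * Polynomial.C (zz 0 0) * gen a c -
            Polynomial.C dt * ((c : Polynomial Pol) * gen a (c - 1))) =
          ((a + c + 1 : ℕ) : Polynomial Pol) * (Polynomial.C (zz 1 0) * gen a c) +
            Polynomial.C dt * ((c : Polynomial Pol) * (Polynomial.X * gen a (c - 1))) := by
        push_cast
        rw [← colF_mul_gen]
        nth_rw 1 [colF]
        ring
      rw [e3, Polynomial.coeff_add, hcast]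
      simp only [Polynomial.coeff_C_mul, natCast_coeff_mul, hs]
      simp
    rw [this]
    exact Submodule.smul_mem _ _ (tP_mem' (by omega) _)
  · have : ((a : ℂ) + c + 1) • (zz 1 1 * tP a c b) -
        dt * ((a : ℂ) • (Polynomial.X * gen (a - 1) c).coeff b) =
        ((a : ℂ) + c + 1 - b) • tP a (c + 1) b := by
      have e := lop_one_one_tP a (c + 1) b
      rw [lop_tP] at e
      simp only [shift, one_ne_zero, if_false, one_mul, gr] at e
      have e2 : ((a : ℂ) + c + 1 - b) = ((a : ℂ) + (c + 1 : ℕ) - b) := by push_cast; ring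
      rw [e2, ← e, cast, hs, tP]
      have e3 : ((a + (c + 1) : ℕ) : Polynomial Pol) * gen a (c + 1) - Polynomial.X *
          (((a + c + 1 : ℕ) : Polynomial Pol) * Polynomial.C (zz 0 1) * gen a c +
            Polynomial.C dt * ((a : Polynomial Pol) * gen (a - 1) c)) =
          ((a + c + 1 : ℕ) : Polynomial Pol) * (Polynomial.C (zz 1 1) * gen a c) -
            Polynomial.C dt * ((a : Polynomial Pol) * (Polynomial.X * gen (a - 1) c)) := by
        push_cast
        rw [← colG_mul_gen]
        nth_rw 1 [colG]
        ring
      rw [e3, Polynomial.coeff_sub, hcast]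
      simp only [Polynomial.coeff_C_mul, natCast_coeff_mul, hs]
    rw [this]
    exact Submodule.smul_mem _ _ (tP_mem' (by omega) _)

/-- Up to the factor d + 1 this is the harmonic projection of z_ij f. It splits z_ij f into a matrix
coefficient part and a `dt` part, which is why `bh` absorbs coordinates times harmonic elements. -/
theorem mul_sub_mem {d : ℕ} {f : Pol} (hf : f ∈ tSpace d) (i j : Fin 2) :
    ((d : ℂ) + 1) • (zz i j * f) - dt * pdd i j f ∈ tSpace (d + 1) := by
  refine map_mem_of_tP (((d : ℂ) + 1) • LinearMap.mulLeft ℂ (zz i j) -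
    LinearMap.mulLeft ℂ dt ∘ₗ pdd i j) _ (fun a c b h => ?_) hf
  subst h
  have := mul_tP_mem i j a c b
  simpa using this

/-! ### The polynomial model of `BH⁺` -/

theorem natDegree_colF : colF.natDegree ≤ 1 := by
  unfold colF; compute_degree

theorem natDegree_colG : colG.natDegree ≤ 1 := by
  unfold colG; compute_degree

theorem natDegree_gen (a c : ℕ) : (gen a c).natDegree ≤ a + c := by
  have h1 := Polynomial.natDegree_pow_le_of_le a natDegree_colF
  have h2 := Polynomial.natDegree_pow_le_of_le c natDegree_colG
  simp only [mul_one] at h1 h2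
  exact Polynomial.natDegree_mul_le_of_le h1 h2

theorem tP_eq_zero {a c b : ℕ} (h : a + c < b) : tP a c b = 0 :=
  Polynomial.coeff_eq_zero_of_natDegree_lt ((natDegree_gen a c).trans_lt h)

theorem tP_top (d : ℕ) : tP d 0 d = zz 0 0 ^ d := by
  have h := Polynomial.coeff_pow_of_natDegree_le (m := d) natDegree_colF
  rw [mul_one] at h
  rw [tP, gen, pow_zero, mul_one, h]
  simp [colF, Polynomial.coeff_C]

theorem tP_bot (d : ℕ) : tP 0 d 0 = zz 1 1 ^ d := by
  rw [tP, gen, pow_zero, one_mul, Polynomial.coeff_zero_eq_eval_zero, Polynomial.eval_pow]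
  simp [colG]

theorem tP_zero : tP 0 0 0 = 1 := by
  simp [tP, gen]

def bh : Submodule ℂ Pol := Submodule.span ℂ {f | ∃ a c b, f = tP a c b ∨ f = dt * tP a c b}

theorem tSpace_le_bh (d : ℕ) : tSpace d ≤ bh :=
  Submodule.span_mono (by rintro _ ⟨a, c, b, _, rfl⟩; exact ⟨a, c, b, Or.inl rfl⟩)

theorem dt_mul_mem_bh {d : ℕ} {f : Pol} (hf : f ∈ tSpace d) : dt * f ∈ bh :=
  map_mem_of_tP (LinearMap.mulLeft ℂ dt) bh
    (fun a c b _ => Submodule.subset_span ⟨a, c, b, Or.inr rfl⟩) hf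

theorem bh_le {S : Submodule ℂ Pol} (h : ∀ d, ∀ f ∈ tSpace d, f ∈ S ∧ dt * f ∈ S) : bh ≤ S :=
  Submodule.span_le.2 (by
    rintro _ ⟨a, c, b, rfl | rfl⟩
    exacts [(h _ _ (tP_mem a c b)).1, (h _ _ (tP_mem a c b)).2])

theorem one_mem_bh : (1 : Pol) ∈ bh := by
  rw [← tP_zero]; exact tSpace_le_bh _ (tP_mem 0 0 0)

theorem pdd_mem {d : ℕ} {f : Pol} (hf : f ∈ tSpace d) (i j : Fin 2) : pdd i j f ∈ tSpace (d - 1) := by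
  rw [pdd_apply, ← smul_eq_C_mul]; exact Submodule.smul_mem _ _ (pd_mem hf _ _)

theorem zz_mul_mem_bh {d : ℕ} {f : Pol} (hf : f ∈ tSpace d) (i j : Fin 2) : zz i j * f ∈ bh := by
  have h := Submodule.add_mem _ (tSpace_le_bh _ (mul_sub_mem hf i j))
    (dt_mul_mem_bh (pdd_mem hf i j))
  rw [sub_add_cancel] at h
  exact (Submodule.smul_mem_iff _ (by exact_mod_cast d.succ_ne_zero)).1 h

theorem zd_mul_mem_bh {d : ℕ} {f : Pol} (hf : f ∈ tSpace d) (i j : Fin 2) : zd i j * f ∈ bh := by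
  rw [zd, mul_assoc, ← smul_eq_C_mul]; exact Submodule.smul_mem _ _ (zz_mul_mem_bh hf _ _)

theorem pd_mem_bh {f : Pol} (hf : f ∈ bh) (i j : Fin 2) : pd i j f ∈ bh := by
  refine bh_le (S := bh.comap (pd i j).toLinearMap) (fun d f hf => ⟨?_, ?_⟩) hf
  · exact tSpace_le_bh _ (pd_mem hf i j)
  · change pd i j (dt * f) ∈ bh
    rw [pd_mul, pd_dt, mul_comm f]
    exact add_mem (dt_mul_mem_bh (pd_mem hf i j)) (zd_mul_mem_bh hf i j)

theorem lop_mem_bh {f : Pol} (hf : f ∈ bh) (i k : Fin 2) : lop i k f ∈ bh := by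
  refine bh_le (S := bh.comap (lop i k).toLinearMap) (fun d f hf => ⟨?_, ?_⟩) hf
  · exact tSpace_le_bh _ (lop_mem hf i k)
  · change lop i k (dt * f) ∈ bh
    rw [lop_dt]
    refine add_mem (dt_mul_mem_bh (lop_mem hf i k)) ?_
    split_ifs
    exacts [dt_mul_mem_bh hf, zero_mem _]

theorem rop_mem_bh {f : Pol} (hf : f ∈ bh) (i k : Fin 2) : rop i k f ∈ bh := by
  refine bh_le (S := bh.comap (rop i k).toLinearMap) (fun d f hf => ⟨?_, ?_⟩) hf
  · exact tSpace_le_bh _ (rop_mem hf i k)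
  · change rop i k (dt * f) ∈ bh
    rw [rop_dt]
    refine add_mem (dt_mul_mem_bh (rop_mem hf i k)) ?_
    split_ifs
    exacts [dt_mul_mem_bh hf, zero_mem _]

/-- On `dt * f` the quadratic field produces `dt` times the harmonic projection from `mul_sub_mem`,
so no genuine second power of `dt` appears. This closes `bh` at exponents 0 and 1. -/
theorem cop_mem_bh {f : Pol} (hf : f ∈ bh) (j i : Fin 2) : cop j i f ∈ bh := by
  refine bh_le (S := bh.comap (cop j i).toLinearMap) (fun d f hf => ⟨?_, ?_⟩) hf
  · change cop j i f ∈ bh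
    rw [cop_eq, eul_eq hf, mul_smul_comm]
    exact sub_mem (Submodule.smul_mem _ _ (zz_mul_mem_bh hf i j)) (dt_mul_mem_bh (pdd_mem hf i j))
  · change cop j i (dt * f) ∈ bh
    have : cop j i (dt * f) = dt * (((d : ℂ) + 1) • (zz i j * f) - dt * pdd i j f) := by
      rw [cop_eq, eul_dt, eul_eq hf, pdd_dt]
      simp only [smul_eq_C_mul, map_add, map_one]
      ring
    rw [this]
    exact dt_mul_mem_bh (mul_sub_mem hf i j)

/-- Needed so that `f - dt * box f` is an admissible test vector for the kernel. -/
theorem dt_mul_box_mem_bh {f : Pol} (hf : f ∈ bh) : dt * box f ∈ bh := by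
  refine bh_le (S := bh.comap (LinearMap.mulLeft ℂ dt ∘ₗ box)) (fun d f hf => ⟨?_, ?_⟩) hf
  · change dt * box f ∈ bh
    rw [box_eq_zero hf, mul_zero]; exact zero_mem _
  · change dt * box (dt * f) ∈ bh
    rw [box_dt, box_eq_zero hf, eul_eq hf, mul_zero, zero_add]
    refine dt_mul_mem_bh (add_mem (Submodule.smul_mem _ _ hf) ?_)
    rw [two_mul]; exact add_mem hf hf

theorem box_box {f : Pol} (hf : f ∈ bh) : box (box f) = 0 := by
  refine (Submodule.mem_bot ℂ).1
    (bh_le (S := (⊥ : Submodule ℂ Pol).comap (box ∘ₗ box)) (fun d f hf => ⟨?_, ?_⟩) hf)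
  · change box (box f) = 0
    rw [box_eq_zero hf, map_zero]
  · change box (box (dt * f)) = 0
    rw [box_dt, box_eq_zero hf, eul_eq hf, mul_zero, zero_add, two_mul]
    simp [box_eq_zero hf]

/-! ### Generation by highest weight vectors -/

/-- Starting from z_00^d, `lop 0 1` lowers the exponent b of s and `rop 1 0` moves factors from the
first column to the second. The scalars met on the way are nonzero, so all matrix coefficients of
degree d are reached. -/
theorem tSpace_le_of_stable {S : Submodule ℂ Pol} {d : ℕ} (hl : ∀ f ∈ S, lop 0 1 f ∈ S)
    (hr : ∀ f ∈ S, rop 1 0 f ∈ S) (h : zz 0 0 ^ d ∈ S) : tSpace d ≤ S := by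
  have h1 : ∀ k b, b + k = d → tP d 0 b ∈ S := by
    intro k
    induction k with
    | zero => rintro b rfl; rw [add_zero] at h; rw [add_zero, tP_top]; exact h
    | succ k ih =>
      rintro b hb
      have := hl _ (ih (b + 1) (by omega))
      rw [lop_zero_one_tP_succ] at this
      refine (Submodule.smul_mem_iff _ ?_).1 this
      rw [← hb]; push_cast
      rw [show ((b : ℂ) + (k + 1) + 0 - b) = k + 1 by ring]
      exact_mod_cast k.succ_ne_zero
  have h2 : ∀ b, tP d 0 b ∈ S := fun b => by
    rcases le_or_gt b d with hb | hb
    · exact h1 (d - b) b (by omega)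
    · rw [tP_eq_zero (by omega)]; exact zero_mem _
  have h3 : ∀ c a b, a + c = d → tP a c b ∈ S := by
    intro c
    induction c with
    | zero => rintro a b rfl; exact h2 b
    | succ c ih =>
      intro a b hb
      have := hr _ (ih (a + 1) b (by omega))
      rw [rop_one_zero_tP] at this
      exact (Submodule.smul_mem_iff _ (by exact_mod_cast a.succ_ne_zero)).1 this
  refine Submodule.span_le.2 ?_
  rintro _ ⟨a, c, b, hd, rfl⟩
  exact h3 c a b hd

/-- `BH⁺` modulo the constants is generated by `z_00`. -/
theorem bh_le_of_stable {S : Submodule ℂ Pol} (hl : ∀ i k, ∀ f ∈ S, lop i k f ∈ S)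
    (hr : ∀ i k, ∀ f ∈ S, rop i k f ∈ S) (hc : ∀ i k, ∀ f ∈ S, cop i k f ∈ S)
    (h1 : (1 : Pol) ∈ S) (hz : zz 0 0 ∈ S) : bh ≤ S := by
  have hp : ∀ n, zz 0 0 ^ (n + 1) ∈ S := by
    intro n
    induction n with
    | zero => simpa using hz
    | succ n ih =>
      have := hc 0 0 _ ih
      -- The field of Z E_00 Z raises the power of z_00. It kills the constants, hence the start at
      -- z_00 and not at 1.
      have e : cop 0 0 (zz 0 0 ^ (n + 1)) = ((n : ℂ) + 1) • zz 0 0 ^ (n + 1 + 1) := by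
        rw [cop_apply]; simp [pd_zz, smul_eq_C_mul]; ring
      rw [e] at this
      exact (Submodule.smul_mem_iff _ (by exact_mod_cast n.succ_ne_zero)).1 this
  have hp' : ∀ n, zz 0 0 ^ n ∈ S := fun n => by
    cases n with
    | zero => simpa using h1
    | succ n => exact hp n
  have hN : ∀ n, dt * zz 0 0 ^ n ∈ S := by
    intro n
    have hn : ((n : ℂ) + 1) ≠ 0 := by exact_mod_cast n.succ_ne_zero
    have hn2 : ((n : ℂ) + 2) ≠ 0 := by exact_mod_cast (n + 1).succ_ne_zero
    have hx := hc 1 1 _ (hp n)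
    have hy := hl 0 1 _ (hr 1 0 _ (hp (n + 1)))
    -- The second vector contains both monomials of `dt * zz 0 0 ^ n`, with the wrong relative
    -- coefficient; the first isolates one of them and allows the correction.
    have ex : cop 1 1 (zz 0 0 ^ (n + 1)) = ((n : ℂ) + 1) • (zz 0 0 ^ n * (zz 0 1 * zz 1 0)) := by
      rw [cop_apply]; simp [pd_zz, smul_eq_C_mul]; ring
    have ey : lop 0 1 (rop 1 0 (zz 0 0 ^ (n + 1 + 1))) =
        ((n : ℂ) + 2) • (((n : ℂ) + 1) • (zz 0 0 ^ n * (zz 0 1 * zz 1 0)) +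
          zz 0 0 ^ (n + 1) * zz 1 1) := by
      rw [rop_apply, lop_apply]
      simp [pd_zz, smul_eq_C_mul, map_ofNat C 2]
      ring
    rw [ex] at hx
    rw [ey, Submodule.smul_mem_iff _ hn2, Submodule.add_mem_iff_right _ hx] at hy
    rw [Submodule.smul_mem_iff _ hn] at hx
    have : dt * zz 0 0 ^ n = zz 0 0 ^ (n + 1) * zz 1 1 - zz 0 0 ^ n * (zz 0 1 * zz 1 0) := by
      rw [dt]; ring
    rw [this]
    exact sub_mem hy hx
  refine bh_le fun d f hf => ⟨tSpace_le_of_stable (hl 0 1) (hr 1 0) (hp' d) hf, ?_⟩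
  -- The off-diagonal fields commute with `dt`, so the same generation argument applies to the
  -- preimage of S under multiplication by `dt`.
  refine tSpace_le_of_stable (S := S.comap (LinearMap.mulLeft ℂ dt)) (d := d) ?_ ?_ (hN d) hf
  · intro f hf
    change dt * lop 0 1 f ∈ S
    have := hl 0 1 _ hf
    rw [LinearMap.mulLeft_apply, lop_dt] at this
    simpa using this
  · intro f hf
    change dt * rop 1 0 f ∈ S
    have := hr 1 0 _ hf
    rw [LinearMap.mulLeft_apply, rop_dt] at this
    simpa using this

/-! ### Weighted Fischer forms -/

/-- The complex conjugate of a coefficient. -/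
def conjCoeff (α : Fin 2 × Fin 2 →₀ ℕ) : Pol →ₗ⋆[ℂ] ℂ where
  toFun g := conj (coeff α g)
  map_add' := by simp
  map_smul' := by simp

def factor (w : ℕ → ℝ) (α : Fin 2 × Fin 2 →₀ ℕ) : ℝ := w α.degree * ∏ x, ((α x).factorial : ℝ)

/-- The sesquilinear form for which the monomials are orthogonal, with
`(x^α, x^α) = w(|α|) α!`. -/
def fis (w : ℕ → ℝ) : Sesq Pol :=
  (basisMonomials (Fin 2 × Fin 2) ℂ).constr ℂ fun α => (factor w α : ℂ) • conjCoeff α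

theorem fis_monomial (w : ℕ → ℝ) (α : Fin 2 × Fin 2 →₀ ℕ) (c : ℂ) (g : Pol) :
    fis w (monomial α c) g = c * factor w α * conj (coeff α g) := by
  have h : (monomial α c : Pol) = c • basisMonomials (Fin 2 × Fin 2) ℂ α := by
    rw [coe_basisMonomials, smul_monomial, smul_eq_mul, mul_one]
  rw [h, map_smul, fis, Module.Basis.constr_basis]
  simp [conjCoeff, mul_assoc]

theorem fis_apply (w : ℕ → ℝ) (f g : Pol) :
    fis w f g = ∑ α ∈ f.support, coeff α f * factor w α * conj (coeff α g) := by
  conv_lhs => rw [f.as_sum]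
  rw [map_sum, LinearMap.sum_apply]
  simp only [fis_monomial]

theorem fis_herm (w : ℕ → ℝ) (f g : Pol) : fis w g f = conj (fis w f g) := by
  rw [fis_apply, fis_apply, map_sum]
  rw [Finset.sum_subset (Finset.subset_union_left (s₂ := f.support)),
    Finset.sum_subset (s₁ := f.support) (Finset.subset_union_right (s₁ := g.support))]
  · refine Finset.sum_congr rfl fun α _ => ?_
    simp only [map_mul, Complex.conj_conj, Complex.conj_ofReal]; ring
  · intro x _ hx; simp [notMem_support_iff.1 hx]
  · intro x _ hx; simp [notMem_support_iff.1 hx]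

theorem prod_factorial_add_single (β : Fin 2 × Fin 2 →₀ ℕ) (i : Fin 2 × Fin 2) :
    ∏ x, (((β + Finsupp.single i 1 : Fin 2 × Fin 2 →₀ ℕ) x).factorial : ℝ) =
      (β i + 1) * ∏ x, ((β x).factorial : ℝ) := by
  rw [← Finset.mul_prod_erase _ _ (Finset.mem_univ i),
    ← Finset.mul_prod_erase (a := i) _ _ (Finset.mem_univ i), ← mul_assoc]
  congr 1
  · simp [Nat.factorial_succ]
  · refine Finset.prod_congr rfl fun x hx => ?_
    simp [(Finset.ne_of_mem_erase hx).symm]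

/-- Raising one exponent multiplies α! by the new exponent, which is the factor that differentiation
produces; the total degree changes by one, hence the shifted weight. -/
theorem fis_pd (w : ℕ → ℝ) (i j : Fin 2) (f g : Pol) :
    fis (fun n => w (n + 1)) (pd i j f) g = fis w f (zz i j * g) := by
  induction f using MvPolynomial.induction_on' with
  | add p q hp hq => simp [hp, hq]
  | monomial α c =>
    rw [pd, pderiv_monomial, fis_monomial, fis_monomial, zz, coeff_X_mul']
    split_ifs with h
    · have h1 : Finsupp.single (i, j) 1 ≤ α := by
        rw [Finsupp.single_le_iff]; exact Nat.one_le_iff_ne_zero.2 (Finsupp.mem_support_iff.1 h)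
      obtain ⟨β, rfl⟩ := exists_add_of_le h1
      rw [add_tsub_cancel_left]
      have : (factor w (Finsupp.single (i, j) 1 + β)) =
          (β (i, j) + 1) * factor (fun n => w (n + 1)) β := by
        rw [add_comm]
        simp only [factor, prod_factorial_add_single, map_add, Finsupp.degree_single]
        ring
      rw [this]; push_cast; simp; ring_nf; simp
    · simp [Finsupp.notMem_support_iff.1 h]

theorem eul_eq_sum (f : Pol) : eul f = ∑ x, X x * pderiv x f := by
  rw [eul_apply, Fintype.sum_prod_type]; simp [Fin.sum_univ_two, zz, pd]; ring

theorem eul_monomial (α : Fin 2 × Fin 2 →₀ ℕ) (c : ℂ) :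
    eul (monomial α c) = (α.degree : ℂ) • monomial α c := by
  rw [eul_eq_sum, (isHomogeneous_monomial c rfl).sum_X_mul_pderiv, Nat.cast_smul_eq_nsmul]

theorem coeff_eul (α : Fin 2 × Fin 2 →₀ ℕ) (f : Pol) : coeff α (eul f) = α.degree * coeff α f := by
  induction f using MvPolynomial.induction_on' with
  | add p q hp hq => simp [hp, hq, mul_add]
  | monomial β c =>
    classical
    rw [eul_monomial, coeff_smul, coeff_monomial, smul_eq_mul]
    split_ifs with h
    · rw [h]
    · simp

theorem fis_eul_right (w : ℕ → ℝ) (f g : Pol) : fis w f (eul g) = fis (fun n => n * w n) f g := by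
  simp only [fis_apply, coeff_eul, factor]
  refine Finset.sum_congr rfl fun α _ => ?_
  simp; ring

theorem fis_eul_left (w : ℕ → ℝ) (f g : Pol) : fis w (eul f) g = fis (fun n => n * w n) f g := by
  rw [fis_herm, fis_eul_right, ← fis_herm]

theorem fis_eul (w : ℕ → ℝ) (f g : Pol) : fis w (eul f) g = fis w f (eul g) := by
  rw [fis_eul_left, fis_eul_right]

theorem fis_pd_right (w : ℕ → ℝ) (i j : Fin 2) (f g : Pol) :
    fis (fun n => w (n + 1)) f (pd i j g) = fis w (zz i j * f) g := by
  rw [fis_herm, fis_pd, ← fis_herm]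

/-- Functions of different degrees are orthogonal. -/
theorem fis_eq_zero {w : ℕ → ℝ} {c c' : ℂ} {f g : Pol} (hc : c ≠ conj c') (hf : eul f = c • f)
    (hg : eul g = c' • g) : fis w f g = 0 := by
  have h := fis_eul w f g
  rw [hf, hg, map_smul, map_smulₛₗ, LinearMap.smul_apply, smul_eq_mul, smul_eq_mul] at h
  have : (c - conj c') * fis w f g = 0 := by rw [sub_mul, h, sub_self]
  exact (mul_eq_zero.1 this).resolve_left (sub_ne_zero.2 hc)

theorem fis_mul_shift (w : ℕ → ℝ) (i j : Fin 2) (f g : Pol) :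
    fis w (zz i j * f) g = fis (fun n => w (n + 1)) f (pd i j g) := (fis_pd_right w i j f g).symm

theorem fis_dt (w : ℕ → ℝ) (f g : Pol) :
    fis w f (dt * g) = fis (fun n => w (n + 2)) (box f) g := by
  have e : ∀ i j k l, fis (fun n => w (n + 2)) (pd i j (pd k l f)) g =
      fis w f (zz k l * (zz i j * g)) := fun i j k l => by
    rw [fis_pd (fun n => w (n + 1)) i j, fis_pd]
  rw [box_apply, map_sub, LinearMap.sub_apply, e, e, ← map_sub]
  rw [dt]; ring_nf

/-- A field z ∂ preserves degree, so the two weight shifts cancel and any weight will do. -/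
theorem fis_lop (w : ℕ → ℝ) (i k : Fin 2) (f g : Pol) :
    fis w (lop i k f) g = fis w f (lop k i g) := by
  simp only [lop_apply, map_add, LinearMap.add_apply, fis_mul_shift, fis_pd]

theorem fis_rop (w : ℕ → ℝ) (i k : Fin 2) (f g : Pol) :
    fis w (rop i k f) g = fis w f (rop k i g) := by
  simp only [rop_apply, map_add, LinearMap.add_apply, fis_mul_shift]
  simp only [← fis_pd w]

/-! ### The invariant form -/

/-- Chosen to satisfy w(n) = n w(n+1), as the adjointness of ∂_ij and the quadratic fields demands.
Its value at 0 is 0, which puts the constants in the kernel. -/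
def wt (n : ℕ) : ℝ := n / n.factorial

theorem wt_eq (n : ℕ) : wt n = n * wt (n + 1) := by
  have h : (n.factorial : ℝ) ≠ 0 := by exact_mod_cast n.factorial_ne_zero
  have h' : ((n : ℝ) + 1) ≠ 0 := by exact_mod_cast n.succ_ne_zero
  simp only [wt, Nat.factorial_succ]; push_cast; field_simp

/-- The invariant form on the polynomial model of `BH⁺`. -/
def frm : Sesq Pol := LinearMap.mk₂'ₛₗ (RingHom.id ℂ) (starRingEnd ℂ)
  (fun f g => fis wt f g - fis (fun n => wt (n + 2)) (box f) (box g))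
  (fun _ _ _ => by simp only [map_add, LinearMap.add_apply]; ring)
  (fun _ _ _ => by simp [mul_sub])
  (fun _ _ _ => by simp only [map_add]; ring)
  (fun _ _ _ => by simp [mul_sub])

theorem frm_apply (f g : Pol) :
    frm f g = fis wt f g - fis (fun n => wt (n + 2)) (box f) (box g) := rfl

theorem frm_herm (f g : Pol) : frm g f = conj (frm f g) := by
  rw [frm_apply, frm_apply, map_sub, ← fis_herm, ← fis_herm]

theorem frm_lop (i k : Fin 2) (f g : Pol) : frm (lop i k f) g = frm f (lop k i g) := by
  simp only [frm_apply, fis_lop, box_lop, map_add, LinearMap.add_apply]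
  by_cases h : i = k
  · simp [h]
  · simp [h, Ne.symm h]

theorem frm_rop (i k : Fin 2) (f g : Pol) : frm (rop i k f) g = frm f (rop k i g) := by
  simp only [frm_apply, fis_rop, box_rop, map_add, LinearMap.add_apply]
  by_cases h : i = k
  · simp [h]
  · simp [h, Ne.symm h]

/-- The recursion of `wt` at degree n + k gives the factor n + k, that is, E + k on polynomials. The
case k = 0 serves the main term of `frm`, and k = 2 the term in `box`. -/
theorem fis_wt_pd (k : ℕ) (i j : Fin 2) (f g : Pol) :
    fis (fun n => wt (n + k)) (pd i j f) g = fis (fun n => wt (n + k)) f (zz i j * (eul g + (k : ℂ) • g)) := by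
  rw [← fis_pd, map_add, map_smulₛₗ, fis_eul_right]
  simp only [fis_apply, smul_eq_mul, Finset.mul_sum, ← Finset.sum_add_distrib]
  refine Finset.sum_congr rfl fun α _ => ?_
  have : factor (fun n => wt (n + k)) α = factor (fun n => n * wt (n + 1 + k)) α +
      k * factor (fun n => wt (n + 1 + k)) α := by
    simp only [factor]
    rw [wt_eq, show α.degree + 1 + k = α.degree + k + 1 by ring]
    push_cast; ring
  rw [this]
  simp; ring

/-- The operators `∂_ij` and `(Z E_ji Z)·∂` are adjoint with respect to the form. -/
theorem frm_pd (i j : Fin 2) (f : Pol) {g : Pol} (hf : box (box f) = 0) :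
    frm (pd i j f) g = frm f (cop j i g) := by
  have h1 := fis_wt_pd 0 i j f g
  have h2 := fis_wt_pd 2 i j (box f) (box g)
  simp only [add_zero, Nat.cast_zero, zero_smul] at h1
  have h3 := fis_dt wt f (pdd i j g)
  have h4 := fis_dt (fun n => wt (n + 2)) (box f) (box (pdd i j g))
  -- Only here is `box (box f) = 0` used: it removes the one term with nothing to cancel it.
  rw [hf, map_zero, LinearMap.zero_apply] at h4
  have e : box (cop j i g) = zz i j * (eul (box g) + ((2 : ℕ) : ℂ) • box g) -
      (pdd i j g + dt * box (pdd i j g)) := by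
    rw [cop_eq, map_sub, box_zz, box_eul, box_dt, pdd_eul, smul_eq_C_mul]
    simp only [Nat.cast_ofNat, map_ofNat]
    ring
  rw [frm_apply, frm_apply, box_pd, h1, h2, e, cop_eq]
  simp only [map_sub, map_add, h4, h3]
  ring

theorem frm_cop (i j : Fin 2) (f : Pol) {g : Pol} (hg : box (box g) = 0) :
    frm (cop j i f) g = frm f (pd i j g) := by
  rw [frm_herm, ← frm_pd i j g hg, ← frm_herm]

/-- `dt` is adjoint to `box` up to a weight shift of 2, so the correction term can be moved into the
first argument. -/
theorem frm_eq (f g : Pol) : frm f g = fis wt (f - dt * box f) g := by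
  rw [frm_apply, map_sub, LinearMap.sub_apply, fis_herm wt g (dt * box f), fis_dt, ← fis_herm]

theorem frm_C (c : ℂ) (g : Pol) : frm (C c) g = 0 := by
  rw [frm_apply, C_apply, fis_monomial, ← C_apply]
  simp [factor, wt, box_apply]

/-- All weights are nonnegative and only degree 0 has weight 0. -/
theorem fis_wt_self {f : Pol} (h : fis wt f f = 0) : ∃ c, f = C c := by
  rw [fis_apply] at h
  have h' : ∑ α ∈ f.support, factor wt α * Complex.normSq (coeff α f) = 0 := by
    have : ((∑ α ∈ f.support, factor wt α * Complex.normSq (coeff α f) : ℝ) : ℂ) = 0 := by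
      rw [← h]; push_cast
      refine Finset.sum_congr rfl fun α _ => ?_
      rw [Complex.normSq_eq_conj_mul_self]; ring
    exact_mod_cast this
  have hw : ∀ α, 0 ≤ factor wt α := fun α => by unfold factor wt; positivity
  rw [Finset.sum_eq_zero_iff_of_nonneg fun α _ => mul_nonneg (hw α) (Complex.normSq_nonneg _)] at h'
  refine ⟨coeff 0 f, ?_⟩
  ext α
  rw [coeff_C]
  split_ifs with h0
  · rw [h0]
  · by_contra hα
    have := h' α (mem_support_iff.2 hα)
    rcases mul_eq_zero.1 this with h2 | h2
    · have hd : α.degree ≠ 0 := fun hd => h0 ((Finsupp.degree_eq_zero_iff α).1 hd).symm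
      have : 0 < factor wt α := by
        have : (0 : ℝ) < α.degree := by exact_mod_cast Nat.pos_of_ne_zero hd
        unfold factor wt; positivity
      exact this.ne' h2
    · exact hα (Complex.normSq_eq_zero.1 h2)

/-- The kernel of the form consists of the constants. -/
theorem frm_kernel {f : Pol} (hf : f ∈ bh) (h : ∀ g ∈ bh, frm f g = 0) : ∃ c, f = C c := by
  -- Testing f against `f - dt * box f` reduces the question to the semidefinite Fischer form.
  have h1 := h _ (sub_mem hf (dt_mul_box_mem_bh hf))
  rw [frm_eq] at h1
  obtain ⟨c, hc⟩ := fis_wt_self h1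
  -- Applying `box` to `f - dt * box f = C c` makes `box f` an Euler eigenvector with eigenvalue -1,
  -- which no nonzero polynomial has.
  have h2 : eul (box f) = (-1 : ℂ) • box f := by
    have := congrArg box hc
    rw [map_sub, box_dt, box_box hf, box_apply (C c)] at this
    simp only [pd_C, map_zero, sub_zero] at this
    rw [neg_one_smul]
    linear_combination -this
  have h3 : box f = 0 := by
    ext α
    have := congrArg (coeff α) h2
    rw [coeff_eul, coeff_smul, smul_eq_mul] at this
    have h4 : ((α.degree : ℂ) + 1) * coeff α (box f) = 0 := by linear_combination this
    simpa using (mul_eq_zero.1 h4).resolve_left (by exact_mod_cast α.degree.succ_ne_zero)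
  rw [h3] at hc
  exact ⟨c, by simpa using hc⟩

/-! ### The Gaussian functional -/

/-- The polynomial that is conjugate to `f` on the real quaternions. -/
def cj : Pol →+* Pol := eval₂Hom (C.comp (starRingEnd ℂ)) fun x => zd x.1 x.2

theorem cj_C (c : ℂ) : cj (C c) = C (conj c) := by simp [cj]

theorem cj_smul (c : ℂ) (f : Pol) : cj (c • f) = conj c • cj f := by
  rw [smul_eq_C_mul, map_mul, cj_C, smul_eq_C_mul]

theorem cj_zz (i j : Fin 2) : cj (zz i j) = zd i j := by simp [cj, zz]

theorem pd_zd (i j k l : Fin 2) :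
    pd i j (zd k l) = if 1 - i = k ∧ 1 - j = l then C (sgn i j) else 0 := by
  fin_cases i <;> fin_cases j <;> fin_cases k <;> fin_cases l <;>
  simp [zd, pd_zz, sgn]

theorem pd_cj (i j : Fin 2) (f : Pol) : pd i j (cj f) = cj (pdd i j f) := by
  have hs : conj (sgn i j) = sgn i j := by unfold sgn; split_ifs <;> simp
  induction f using MvPolynomial.induction_on with
  | C c => rw [cj_C, pdd_apply, pd_C, pd_C]; simp
  | add p q hp hq => simp [hp, hq]
  | mul_X p x hp =>
    change pd i j (cj (p * zz x.1 x.2)) = cj (pdd i j (p * zz x.1 x.2))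
    rw [map_mul, pd_mul, hp, pdd_apply, pdd_apply, pd_mul, cj_zz, pd_zd, pd_zz]
    simp only [map_mul, map_add, cj_C, hs, cj_zz]
    split_ifs <;> simp <;> ring

/-- On the real quaternions z_11 is the conjugate of z_00 and z_01 is minus the conjugate of z_10.
The values are products of two planar Gaussian moments; the power of -1 comes from z_01. -/
def lamCoeff (α : Fin 2 × Fin 2 →₀ ℕ) : ℂ :=
  if α (0, 0) = α (1, 1) ∧ α (0, 1) = α (1, 0) then
    ((α (0, 0)).factorial : ℂ) * (α (0, 1)).factorial * (-1) ^ α (0, 1) else 0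

/-- The normalized Gaussian integral over the real quaternions. -/
def lam : Pol →ₗ[ℂ] ℂ := (basisMonomials (Fin 2 × Fin 2) ℂ).constr ℂ lamCoeff

theorem lam_monomial (α : Fin 2 × Fin 2 →₀ ℕ) (c : ℂ) : lam (monomial α c) = c * lamCoeff α := by
  have h : (monomial α c : Pol) = c • basisMonomials (Fin 2 × Fin 2) ℂ α := by
    rw [coe_basisMonomials, smul_monomial, smul_eq_mul, mul_one]
  rw [h, map_smul, lam, Module.Basis.constr_basis, smul_eq_mul]

theorem lamCoeff_add_single (α : Fin 2 × Fin 2 →₀ ℕ) (i j : Fin 2) :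
    sgn i j * lamCoeff (Finsupp.single (1 - i, 1 - j) 1 + α) =
      α (i, j) * lamCoeff (α - Finsupp.single (i, j) 1) := by
  have h : ∀ n m : ℕ, (n + 1 = 1 + m) = (n = m) := fun n m => by
    rw [eq_iff_iff]; omega
  have h' : ∀ n m : ℕ, (1 + m = n + 1) = (m = n) := fun n m => by
    rw [eq_iff_iff]; omega
  have h0 : ∀ m : ℕ, ¬ (0 = 1 + m) := fun m => by omega
  fin_cases i <;> fin_cases j <;> simp [lamCoeff, sgn]
  · rcases α (0, 0) with _ | n
    · simp [h0]
    · simp only [h, Nat.add_sub_cancel, Nat.factorial_succ]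
      split_ifs <;> push_cast <;> ring
  · rcases α (0, 1) with _ | n
    · simp [h0]
    · simp only [h, Nat.add_sub_cancel, Nat.factorial_succ]
      split_ifs <;> push_cast <;> ring
  · rcases α (1, 0) with _ | n
    · simp
    · simp only [h', Nat.add_sub_cancel]
      split_ifs with hc
      · rw [hc.2, add_comm 1 n, Nat.factorial_succ]; push_cast; ring
      · simp
  · rcases α (1, 1) with _ | n
    · simp
    · simp only [h', Nat.add_sub_cancel]
      split_ifs with hc
      · rw [hc.1, add_comm 1 n, Nat.factorial_succ]; push_cast; ring
      · simp

/-- Integration by parts: the Gaussian density is exp(-N), and the derivative of N along z_ij is its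
cofactor. -/
theorem lam_zd_mul (i j : Fin 2) (f : Pol) : lam (zd i j * f) = lam (pd i j f) := by
  induction f using MvPolynomial.induction_on' with
  | add p q hp hq => simp [mul_add, hp, hq]
  | monomial α c =>
    have h : zd i j * monomial α c =
        monomial (Finsupp.single (1 - i, 1 - j) 1 + α) (sgn i j * c) := by
      rw [zd, zz, X, C_mul_monomial, monomial_mul, mul_one]
    rw [h, pd, pderiv_monomial, lam_monomial, lam_monomial]
    linear_combination c * lamCoeff_add_single α i j

theorem lam_zz_mul (i j : Fin 2) (f : Pol) : lam (zz i j * f) = lam (pdd i j f) := by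
  have h : zz i j * f = sgn i j • (zd (1 - i) (1 - j) * f) := by
    rw [smul_eq_C_mul]
    fin_cases i <;> fin_cases j <;> simp [zd, sgn]
  rw [h, map_smul, lam_zd_mul, pdd_apply, ← smul_eq_C_mul, map_smul]

theorem eul_eq_sum' (f : Pol) : eul f = ∑ i, ∑ j, zz i j * pd i j f := by
  simp [eul_apply, Fin.sum_univ_two]; ring

theorem eq_C_of_eul {f : Pol} (hf : eul f = 0) : f = C (coeff 0 f) := by
  ext α
  rw [coeff_C]
  split_ifs with h
  · rw [h]
  · have := congrArg (coeff α) hf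
    rw [coeff_eul, coeff_zero] at this
    refine (mul_eq_zero.1 this).resolve_left ?_
    exact_mod_cast fun hd => h ((Finsupp.degree_eq_zero_iff α).1 hd).symm

/-- A mean value property. Expanding the Euler field and integrating by parts turns `lam (eul f)`
into `lam (2 * box f)`, which is zero, so a homogeneous harmonic f of nonzero degree has mean 0. -/
theorem lam_eq_coeff {f : Pol} {c : ℂ} (hf : box f = 0) (he : eul f = c • f) :
    lam f = coeff 0 f := by
  rcases eq_or_ne c 0 with rfl | hc
  · rw [zero_smul] at he
    rw [eq_C_of_eul he, C_apply, lam_monomial]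
    simp [lamCoeff]
  · have h1 : lam (eul f) = 0 := by
      rw [eul_eq_sum']
      simp only [map_sum, lam_zz_mul]
      simp only [← map_sum, sum_zz_pdd_pd, hf, mul_zero, map_zero]
    have h2 : coeff 0 (eul f) = 0 := by rw [coeff_eul]; simp
    rw [he] at h1 h2
    rw [map_smul, smul_eq_mul] at h1
    rw [coeff_smul, smul_eq_mul] at h2
    rw [(mul_eq_zero.1 h1).resolve_left hc, (mul_eq_zero.1 h2).resolve_left hc]

/-- On harmonic polynomials, the Gaussian inner product is the Fischer inner product. -/
theorem lam_mul_cj (e : ℕ) : ∀ (c : ℂ) (f g : Pol), box f = 0 → box g = 0 → eul f = c • f →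
    eul g = (e : ℂ) • g → lam (f * cj g) = fis (fun _ => 1) f g := by
  induction e with
  | zero =>
    intro c f g hf hg hef heg
    rw [Nat.cast_zero, zero_smul] at heg
    rw [eq_C_of_eul heg, cj_C, mul_comm, ← smul_eq_C_mul, map_smul, lam_eq_coeff hf hef, fis_herm,
      C_apply, fis_monomial]
    simp [factor]
  | succ e ih =>
    intro c f g hf hg hef heg
    have he : ((e : ℂ) + 1) ≠ 0 := by exact_mod_cast e.succ_ne_zero
    -- Euler's identity writes g as a sum of z_ij ∂_ij g. The conjugate of z_ij is its cofactor,
    -- which integration by parts turns into ∂_ij.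
    have h1 : lam (f * cj (eul g)) = fis (fun _ => 1) f (eul g) := by
      have h2 : ∀ i j, lam (f * cj (zz i j * pd i j g)) =
          fis (fun _ => 1) f (zz i j * pd i j g) + lam (f * cj (pdd i j (pd i j g))) := by
        intro i j
        rw [map_mul cj, cj_zz, mul_left_comm, lam_zd_mul, pd_mul, map_add, pd_cj,
          ← fis_pd (fun _ => 1), add_comm, mul_comm (cj _)]
        congr 1
        -- Both degrees drop by one. The eigenvalue of f is any complex number, so `c - 1` needs no
        -- lower bound.
        refine ih (c - 1) _ _ (by rw [box_pd, hf, map_zero]) (by rw [box_pd, hg, map_zero]) ?_ ?_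
        · have := pd_eul i j f
          rw [hef, Derivation.map_smul] at this
          rw [sub_smul, one_smul, this, add_sub_cancel_right]
        · have := pd_eul i j g
          rw [heg, Derivation.map_smul] at this
          push_cast at this
          rw [add_smul, one_smul] at this
          exact (add_right_cancel this).symm
      rw [eul_eq_sum']
      simp only [map_sum, Finset.mul_sum, h2, Finset.sum_add_distrib]
      -- The derivatives that fall on the conjugate factor add up to the conjugate of `2 * box g`,
      -- which is zero.
      rw [add_eq_left]
      simp only [← map_sum, ← Finset.mul_sum, sum_zz_pdd_pd, hg, mul_zero, map_zero]
    rw [heg, cj_smul, mul_smul_comm, map_smul, map_smulₛₗ] at h1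
    push_cast at h1
    simp only [map_add, map_natCast, map_one, smul_eq_mul] at h1
    exact mul_left_cancel₀ he h1

/-! ### Values of the form -/

theorem fis_eq_mul {w : ℕ → ℝ} {d : ℕ} {g : Pol} (hg : eul g = (d : ℂ) • g) (f : Pol) :
    fis w f g = w d * fis (fun _ => 1) f g := by
  rw [fis_apply, fis_apply, Finset.mul_sum]
  refine Finset.sum_congr rfl fun α _ => ?_
  have h := congrArg (coeff α) hg
  rw [coeff_eul, coeff_smul, smul_eq_mul] at h
  by_cases h0 : coeff α g = 0
  · simp [h0]
  · have : α.degree = d := by exact_mod_cast mul_right_cancel₀ h0 h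
    simp only [factor, this]; push_cast; ring

theorem fis_tSpace_eq_zero (w : ℕ → ℝ) {d d' : ℕ} (h : d ≠ d') {f g : Pol} (hf : f ∈ tSpace d)
    (hg : g ∈ tSpace d') : fis w f g = 0 :=
  fis_eq_zero (by simpa using h) (eul_eq hf) (eul_eq hg)

theorem frm_tSpace {d d' : ℕ} {f g : Pol} (hf : f ∈ tSpace d) (hg : g ∈ tSpace d') :
    frm f g = wt d * fis (fun _ => 1) f g := by
  rw [frm_apply, box_eq_zero hf, map_zero, LinearMap.zero_apply, sub_zero]
  rcases eq_or_ne d d' with rfl | h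
  · exact fis_eq_mul (eul_eq hg) f
  · rw [fis_tSpace_eq_zero _ h hf hg, fis_tSpace_eq_zero _ h hf hg, mul_zero]

theorem box_dt_mul {d : ℕ} {f : Pol} (hf : f ∈ tSpace d) : box (dt * f) = ((d : ℂ) + 2) • f := by
  rw [box_dt, box_eq_zero hf, eul_eq hf, mul_zero, zero_add, add_smul, two_smul, two_mul]

/-- With `box (dt * f) = (d + 2) f`, the main term contributes d + 2 and the correction (d + 2)²;
the difference -(d + 1)(d + 2) is the source of the negative sign. -/
theorem frm_dt_dt {d d' : ℕ} {f g : Pol} (hf : f ∈ tSpace d) (hg : g ∈ tSpace d') :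
    frm (dt * f) (dt * g) = -((d + 1) * (d + 2) * wt (d + 2)) * fis (fun _ => 1) f g := by
  rw [frm_apply, fis_dt, box_dt_mul hf, box_dt_mul hg, map_smul, map_smulₛₗ]
  rcases eq_or_ne d d' with rfl | h
  · rw [LinearMap.smul_apply, fis_eq_mul (eul_eq hg)]
    simp [map_ofNat (starRingEnd ℂ) 2]; ring
  · simp only [LinearMap.smul_apply]
    rw [fis_tSpace_eq_zero _ h hf hg, fis_tSpace_eq_zero _ h hf hg]; simp

theorem frm_tSpace_dt {d : ℕ} {f : Pol} (hf : f ∈ tSpace d) (g : Pol) : frm f (dt * g) = 0 := by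
  rw [frm_apply, fis_dt, box_eq_zero hf]; simp

theorem frm_dt_tSpace {d : ℕ} {f : Pol} (hf : f ∈ tSpace d) (g : Pol) : frm (dt * g) f = 0 := by
  rw [frm_herm, frm_tSpace_dt hf, map_zero]

section SphereIntegrals

open MeasureTheory Set


/-! ### Integrals of monomials over the sphere -/

abbrev E4 := EuclideanSpace ℝ (Fin 4)

/-- Polar coordinates for the Gaussian integral of a homogeneous function. -/
theorem integral_gauss_polar (m : E4 → ℂ) (n : ℕ)
    (hm : ∀ (r : ℝ) (x : E4), m (r • x) = (r : ℂ) ^ n * m x) :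
    ∫ x, m x * (Real.exp (-‖x‖ ^ 2) : ℂ) =
      (∫ x, m x.1 ∂(volume (α := E4)).toSphere) * ((1 / 2 * Real.Gamma ((n + 4) / 2) : ℝ) : ℂ) := by
  have hfin : Module.finrank ℝ E4 - 1 = 3 := by simp
  calc
    ∫ x, m x * (Real.exp (-‖x‖ ^ 2) : ℂ) =
        ∫ x : ({(0)}ᶜ : Set E4), m x * (Real.exp (-‖x.1‖ ^ 2) : ℂ) ∂((volume (α := E4)).comap (↑)) := by
      rw [integral_subtype_comap (measurableSet_singleton _).compl
        fun x : E4 => m x * (Real.exp (-‖x‖ ^ 2) : ℂ), restrict_compl_singleton]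
    _ = ∫ x, m x.1 * ((x.2.1 : ℂ) ^ n * (Real.exp (-x.2.1 ^ 2) : ℂ))
        ∂((volume (α := E4)).toSphere.prod (.volumeIoiPow (Module.finrank ℝ E4 - 1))) := by
      rw [← (volume (α := E4)).measurePreserving_homeomorphUnitSphereProd.integral_comp
        (Homeomorph.measurableEmbedding _)]
      refine integral_congr_ae (Filter.Eventually.of_forall fun x => ?_)
      have hx : ‖x.1‖ ≠ 0 := norm_ne_zero_iff.2 x.2
      have : x.1 = ‖x.1‖ • (‖x.1‖⁻¹ • x.1) := by rw [smul_smul, mul_inv_cancel₀ hx, one_smul]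
      simp only [homeomorphUnitSphereProd_apply_snd_coe, homeomorphUnitSphereProd_apply_fst_coe]
      conv_lhs => rw [this, hm]
      rw [← this]; ring
    _ = (∫ x, m x.1 ∂(volume (α := E4)).toSphere) *
        ∫ x : Ioi (0 : ℝ), ((x.1 : ℂ) ^ n * (Real.exp (-x.1 ^ 2) : ℂ)) ∂.volumeIoiPow 3 := by
      rw [hfin]
      exact integral_prod_mul (fun x : Metric.sphere (0 : E4) 1 => m x.1)
        (fun x : Ioi (0 : ℝ) => ((x.1 : ℂ) ^ n * (Real.exp (-x.1 ^ 2) : ℂ)))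
    _ = _ := by
      congr 1
      -- The exponent is n from homogeneity plus 3 from the radial measure in dimension 4.
      have hG := integral_rpow_mul_exp_neg_rpow (p := 2) (q := n + 3) (by norm_num)
        (by have : (0 : ℝ) ≤ n := n.cast_nonneg
            linarith)
      rw [show ((n : ℝ) + 3 + 1) / 2 = (n + 4) / 2 by ring] at hG
      rw [← hG]
      simp only [Measure.volumeIoiPow, ENNReal.ofReal]
      rw [integral_withDensity_eq_integral_smul,
        integral_subtype_comap measurableSet_Ioi fun a : ℝ => Real.toNNReal (a ^ 3) •
          ((a : ℂ) ^ n * (Real.exp (-a ^ 2) : ℂ)), ← integral_complex_ofReal]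
      · refine setIntegral_congr_fun measurableSet_Ioi fun x hx => ?_
        have hx' : (0 : ℝ) ≤ x := le_of_lt hx
        simp only [NNReal.smul_def, Real.coe_toNNReal _ (pow_nonneg hx' 3)]
        have : x ^ ((n : ℝ) + 3) = x ^ n * x ^ 3 := by
          rw [← pow_add, ← Real.rpow_natCast]; push_cast; rfl
        rw [this, Real.rpow_ofNat]
        simp only [Complex.real_smul]; push_cast; ring
      · exact (measurable_subtype_coe.pow_const _).real_toNNReal

/-- The identification of the real quaternions with `ℂ²`. -/
def quatIso : E4 ≃ₗᵢ[ℝ] WithLp 2 (ℂ × ℂ) where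
  toFun x := WithLp.toLp 2 (⟨x 0, -x 3⟩, ⟨x 2, -x 1⟩)
  invFun z := !₂[z.fst.re, -z.snd.im, z.snd.re, -z.fst.im]
  map_add' x y := by
    apply WithLp.ofLp_injective
    ext <;> apply Complex.ext <;> simp <;> ring
  map_smul' c x := by
    apply WithLp.ofLp_injective
    ext <;> apply Complex.ext <;> simp
  left_inv x := by
    ext i; fin_cases i <;> simp
  right_inv z := by
    apply WithLp.ofLp_injective
    ext <;> simp
  norm_map' x := by
    rw [← sq_eq_sq₀ (norm_nonneg _) (norm_nonneg _), EuclideanSpace.norm_sq_eq,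
      WithLp.prod_norm_sq_eq_of_L2]
    simp [Fin.sum_univ_four, ← Complex.normSq_eq_norm_sq, Complex.normSq_apply]
    ring

theorem integral_complex_gauss (i j : ℕ) :
    ∫ z : ℂ, z ^ i * conj z ^ j * (Real.exp (-‖z‖ ^ 2) : ℂ) =
      if i = j then (Real.pi * i.factorial : ℂ) else 0 := by
  split_ifs with h
  · subst h
    have hG := Complex.integral_rpow_mul_exp_neg_rpow (p := 2) (q := 2 * i) (by norm_num)
      (by have : (0 : ℝ) ≤ i := i.cast_nonneg
          linarith)
    rw [show (2 * (i : ℝ) + 2) / 2 = i + 1 by ring, Real.Gamma_nat_eq_factorial] at hG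
    have : (∫ z : ℂ, z ^ i * conj z ^ i * (Real.exp (-‖z‖ ^ 2) : ℂ)) =
        ((∫ x : ℂ, ‖x‖ ^ (2 * i : ℝ) * Real.exp (-‖x‖ ^ (2 : ℝ)) : ℝ) : ℂ) := by
      rw [← integral_complex_ofReal]
      congr 1; ext z
      rw [← mul_pow, Complex.mul_conj, Complex.normSq_eq_norm_sq]
      have : ‖z‖ ^ (2 * (i : ℝ)) = (‖z‖ ^ 2) ^ i := by
        rw [← pow_mul, ← Real.rpow_natCast]; push_cast; rfl
      rw [this]; simp
    rw [this, hG]; push_cast; ring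
  · have hij : ((i : ℂ) - j) ≠ 0 := sub_ne_zero.2 (by exact_mod_cast h)
    -- Rotation by this angle multiplies the integrand by exp(iπ) = -1 and preserves the measure, so
    -- the integral vanishes.
    set u : Circle := Circle.exp (Real.pi / (i - j)) with hu
    have hu1 : (u : ℂ) ^ i * conj (u : ℂ) ^ j = -1 := by
      rw [hu, Circle.coe_exp, ← Complex.exp_conj, ← Complex.exp_nat_mul, ← Complex.exp_nat_mul,
        ← Complex.exp_add, ← Complex.exp_pi_mul_I]
      congr 1
      simp only [map_mul, Complex.conj_ofReal, Complex.conj_I]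
      push_cast
      field_simp
      ring
    have hr := (rotation u).measurePreserving.integral_comp'
      (f := (rotation u).toHomeomorph.toMeasurableEquiv)
      (g := fun z : ℂ => z ^ i * conj z ^ j * (Real.exp (-‖z‖ ^ 2) : ℂ))
    have hr' : (∫ z : ℂ, (u : ℂ) ^ i * conj (u : ℂ) ^ j *
        (z ^ i * conj z ^ j * (Real.exp (-‖z‖ ^ 2) : ℂ))) =
        ∫ z : ℂ, z ^ i * conj z ^ j * (Real.exp (-‖z‖ ^ 2) : ℂ) := by
      rw [← hr]
      congr 1; ext z
      have e : (rotation u).toHomeomorph.toMeasurableEquiv z = u * z := rfl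
      rw [e, norm_mul, Circle.norm_coe, one_mul, map_mul]
      ring
    rw [integral_const_mul, hu1] at hr'
    exact self_eq_neg.1 (by linear_combination -hr')

/-- The Gaussian integral of a monomial. -/
theorem integral_quat_gauss (i j k l : ℕ) :
    ∫ x : E4, (quat x 0 0 ^ i * quat x 1 1 ^ j * (quat x 0 1 ^ k * quat x 1 0 ^ l)) *
      (Real.exp (-‖x‖ ^ 2) : ℂ) =
    Real.pi ^ 2 * if i = j ∧ k = l then (i.factorial : ℂ) * k.factorial * (-1) ^ k else 0 := by
  have h1 := quatIso.measurePreserving.integral_comp' (f := quatIso.toHomeomorph.toMeasurableEquiv)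
    (g := fun z : WithLp 2 (ℂ × ℂ) => (z.fst ^ i * conj z.fst ^ j * (Real.exp (-‖z.fst‖ ^ 2) : ℂ)) *
      ((-1) ^ k * (z.snd ^ l * conj z.snd ^ k * (Real.exp (-‖z.snd‖ ^ 2) : ℂ))))
  have h2 := (WithLp.volume_preserving_ofLp ℂ ℂ).integral_comp'
    (f := (MeasurableEquiv.toLp 2 (ℂ × ℂ)).symm)
    (g := fun z : ℂ × ℂ => (z.1 ^ i * conj z.1 ^ j * (Real.exp (-‖z.1‖ ^ 2) : ℂ)) *
      ((-1) ^ k * (z.2 ^ l * conj z.2 ^ k * (Real.exp (-‖z.2‖ ^ 2) : ℂ))))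
  have h3 : ∫ z : ℂ × ℂ, (z.1 ^ i * conj z.1 ^ j * (Real.exp (-‖z.1‖ ^ 2) : ℂ)) *
      ((-1) ^ k * (z.2 ^ l * conj z.2 ^ k * (Real.exp (-‖z.2‖ ^ 2) : ℂ))) =
      Real.pi ^ 2 * if i = j ∧ k = l then (i.factorial : ℂ) * k.factorial * (-1) ^ k else 0 := by
    refine (integral_prod_mul (fun z : ℂ => z ^ i * conj z ^ j * (Real.exp (-‖z‖ ^ 2) : ℂ))
      (fun z : ℂ => (-1) ^ k * (z ^ l * conj z ^ k * (Real.exp (-‖z‖ ^ 2) : ℂ)))).trans ?_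
    rw [integral_const_mul, integral_complex_gauss, integral_complex_gauss]
    by_cases hi : i = j
    · by_cases hk : k = l
      · simp [hi, hk]; ring
      · simp [hi, hk, Ne.symm hk]
    · simp [hi]
  rw [← h3, ← h2]
  refine Eq.trans ?_ h1
  congr 1; ext x
  have e1 : (quatIso.toHomeomorph.toMeasurableEquiv x).fst = ⟨x 0, -x 3⟩ := rfl
  have e2 : (quatIso.toHomeomorph.toMeasurableEquiv x).snd = ⟨x 2, -x 1⟩ := rfl
  have e3 : ‖x‖ ^ 2 = ‖(⟨x 0, -x 3⟩ : ℂ)‖ ^ 2 + ‖(⟨x 2, -x 1⟩ : ℂ)‖ ^ 2 := by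
    rw [EuclideanSpace.norm_sq_eq]
    simp [Fin.sum_univ_four, ← Complex.normSq_eq_norm_sq, Complex.normSq_apply]
    ring
  have q1 : quat x 0 0 = ⟨x 0, -x 3⟩ := by apply Complex.ext <;> simp [quat]
  have q2 : quat x 1 1 = conj (⟨x 0, -x 3⟩ : ℂ) := by apply Complex.ext <;> simp [quat]
  have q3 : quat x 0 1 = -conj (⟨x 2, -x 1⟩ : ℂ) := by apply Complex.ext <;> simp [quat]
  have q4 : quat x 1 0 = ⟨x 2, -x 1⟩ := by apply Complex.ext <;> simp [quat]
  rw [e1, e2, e3, q1, q2, q3, q4, neg_add, Real.exp_add, neg_pow (conj _)]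
  push_cast; ring

/-- The values of the coordinates at a real quaternion. -/
def qv (x : E4) : Fin 2 × Fin 2 → ℂ := fun p => quat x p.1 p.2

theorem continuous_qv (p : Fin 2 × Fin 2) : Continuous fun x => qv x p := by
  obtain ⟨i, j⟩ := p
  fin_cases i <;> fin_cases j <;> simp only [qv, quat] <;> simp <;> fun_prop

theorem continuous_eval_qv (f : Pol) : Continuous fun x => eval (qv x) f := by
  induction f using MvPolynomial.induction_on with
  | C c => simpa using continuous_const
  | add p q hp hq => simp only [map_add]; exact hp.add hq
  | mul_X p x hp => simp only [map_mul, eval_X]; exact hp.mul (continuous_qv x)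

theorem integrable_eval_qv (f : Pol) : Integrable
    (fun x : Metric.sphere (0 : E4) 1 => eval (qv x.1) f) (volume (α := E4)).toSphere :=
  ((continuous_eval_qv f).comp continuous_subtype_val).integrable_of_hasCompactSupport
    (HasCompactSupport.of_compactSpace _)

theorem degree_eq (α : Fin 2 × Fin 2 →₀ ℕ) :
    α.degree = α (0, 0) + α (1, 1) + (α (0, 1) + α (1, 0)) := by
  rw [Finsupp.degree_eq_sum, Fintype.sum_prod_type]
  simp [Fin.sum_univ_two]; ring

theorem sphere_monomial (α : Fin 2 × Fin 2 →₀ ℕ) (c : ℂ) :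
    (∫ x, eval (qv x.1) (monomial α c) ∂(volume (α := E4)).toSphere) *
      (Real.Gamma ((α.degree + 4) / 2) : ℂ) = 2 * Real.pi ^ 2 * lam (monomial α c) := by
  have hm : ∀ x, eval (qv x) (monomial α c) = c * (quat x 0 0 ^ α (0, 0) * quat x 1 1 ^ α (1, 1) *
      (quat x 0 1 ^ α (0, 1) * quat x 1 0 ^ α (1, 0))) := fun x => by
    rw [eval_monomial, Finsupp.prod_fintype _ _ (by simp), Fintype.prod_prod_type]
    simp [Fin.prod_univ_two, qv]; ring_nf; simp
  have hq : ∀ (r : ℝ) (x : E4) (i j : Fin 2), quat (r • x) i j = r * quat x i j := by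
    intro r x i j
    fin_cases i <;> fin_cases j <;> simp [quat] <;> ring
  have h := integral_gauss_polar (fun x => quat x 0 0 ^ α (0, 0) * quat x 1 1 ^ α (1, 1) *
      (quat x 0 1 ^ α (0, 1) * quat x 1 0 ^ α (1, 0))) α.degree (fun r x => by
        simp only [hq, degree_eq, pow_add, mul_pow]; ring)
  rw [integral_quat_gauss] at h
  simp only [hm, integral_const_mul, lam_monomial, lamCoeff]
  push_cast at h ⊢
  linear_combination -2 * c * h

/-- All monomials of a homogeneous polynomial share the same radial Gamma factor, so the Gaussian
and spherical integrals are proportional. -/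
theorem sphere_eul {f : Pol} {n : ℕ} (hf : eul f = (n : ℂ) • f) :
    (∫ x, eval (qv x.1) f ∂(volume (α := E4)).toSphere) *
      (Real.Gamma ((n + 4) / 2) : ℂ) = 2 * Real.pi ^ 2 * lam f := by
  have h1 : (∫ x, eval (qv x.1) f ∂(volume (α := E4)).toSphere) =
      ∑ α ∈ f.support, ∫ x, eval (qv x.1) (monomial α (coeff α f)) ∂(volume (α := E4)).toSphere := by
    rw [← integral_finsetSum _ fun α _ => integrable_eval_qv _]
    congr 1; ext x
    rw [← map_sum, ← f.as_sum]
  have h2 : lam f = ∑ α ∈ f.support, lam (monomial α (coeff α f)) := by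
    rw [← map_sum, ← f.as_sum]
  rw [h1, h2, Finset.sum_mul, Finset.mul_sum]
  refine Finset.sum_congr rfl fun α hα => ?_
  have h := congrArg (coeff α) hf
  rw [coeff_eul, coeff_smul, smul_eq_mul] at h
  have hd : α.degree = n := by exact_mod_cast mul_right_cancel₀ (mem_support_iff.1 hα) h
  rw [← sphere_monomial, hd]

theorem conj_qv (x : E4) (i j : Fin 2) : eval (qv x) (zd i j) = conj (qv x (i, j)) := by
  fin_cases i <;> fin_cases j <;> simp [zd, zz, sgn, qv, quat, Complex.ext_iff]

theorem eval_cj (x : E4) (f : Pol) : eval (qv x) (cj f) = conj (eval (qv x) f) := by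
  induction f using MvPolynomial.induction_on with
  | C c => simp [cj_C]
  | add p q hp hq => simp [hp, hq]
  | mul_X p y hp =>
    have : cj (X y) = zd y.1 y.2 := cj_zz _ _
    rw [map_mul, map_mul, hp, this, conj_qv, map_mul, map_mul, eval_X]

theorem eul_cj (f : Pol) : eul (cj f) = cj (eul f) := by
  have h : ∀ i j, zz i j * cj (pdd i j f) = cj (zz (1 - i) (1 - j) * pd (1 - i) (1 - j) f) := by
    intro i j
    rw [map_mul, cj_zz, pdd_apply, map_mul, cj_C]
    fin_cases i <;> fin_cases j <;> simp [zd, sgn]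
  rw [eul_eq_sum', eul_eq_sum']
  simp only [pd_cj, h, Fin.sum_univ_two, map_add, sub_zero, sub_self]
  ring

/-- The inner product of matrix coefficients over the unit sphere. -/
theorem sphere_inner {d d' : ℕ} {f g : Pol} (hf : f ∈ tSpace d) (hg : g ∈ tSpace d') :
    (∫ x, eval (qv x.1) f * conj (eval (qv x.1) g) ∂(volume (α := E4)).toSphere) *
      ((d + 1).factorial : ℂ) = 2 * Real.pi ^ 2 * fis (fun _ => 1) f g := by
  have h1 : eul (f * cj g) = ((d + d' : ℕ) : ℂ) • (f * cj g) := by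
    rw [Derivation.leibniz, eul_cj, eul_eq hf, eul_eq hg, cj_smul]
    simp only [smul_eq_mul, smul_eq_C_mul]; push_cast
    simp only [map_add, map_natCast]; ring
  have h := sphere_eul h1
  rw [lam_mul_cj d' d f g (box_eq_zero hf) (box_eq_zero hg) (eul_eq hf) (eul_eq hg)] at h
  simp only [map_mul, eval_cj] at h
  rcases eq_or_ne d d' with rfl | hd
  · rw [← h]
    congr 2
    -- The product has degree 2d, and Γ(d + 2) = (d + 1)!.
    rw [show (((d + d : ℕ) : ℝ) + 4) / 2 = ((d + 1 : ℕ) : ℝ) + 1 by push_cast; ring,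
      Real.Gamma_nat_eq_factorial, Complex.ofReal_natCast]
  · rw [fis_tSpace_eq_zero _ hd hf hg, mul_zero] at h ⊢
    have hG : (Real.Gamma (((d + d' : ℕ) + 4) / 2) : ℂ) ≠ 0 := by
      exact_mod_cast (Real.Gamma_pos_of_pos (by positivity)).ne'
    rw [(mul_eq_zero.1 h).resolve_right hG, zero_mul]

end SphereIntegrals

/-! ### The action on polynomials -/

/-- The action of `gl(2, HC)` on polynomials. -/
def op (X : GlAlg) : Pol →ₗ[ℂ] Pol :=
  -(∑ i, ∑ k, X.toBlocks₁₁ i k • (lop i k).toLinearMap) -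
    (∑ i, ∑ j, X.toBlocks₁₂ i j • (pd i j).toLinearMap) +
    (∑ j, ∑ i, X.toBlocks₂₁ j i • (cop j i).toLinearMap) +
    ∑ k, ∑ j, X.toBlocks₂₂ k j • (rop k j).toLinearMap

theorem op_apply (X : GlAlg) (f : Pol) : op X f =
    -(∑ i, ∑ k, X.toBlocks₁₁ i k • lop i k f) - (∑ i, ∑ j, X.toBlocks₁₂ i j • pd i j f) +
    (∑ j, ∑ i, X.toBlocks₂₁ j i • cop j i f) + ∑ k, ∑ j, X.toBlocks₂₂ k j • rop k j f := by
  simp [op]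

theorem op_mem_bh (X : GlAlg) {f : Pol} (hf : f ∈ bh) : op X f ∈ bh := by
  rw [op_apply]
  refine add_mem (add_mem (sub_mem (neg_mem ?_) ?_) ?_) ?_ <;>
  refine sum_mem fun i _ => sum_mem fun j _ => Submodule.smul_mem _ _ ?_
  exacts [lop_mem_bh hf _ _, pd_mem_bh hf _ _, cop_mem_bh hf _ _, rop_mem_bh hf _ _]

theorem op_add (X Y : GlAlg) (f : Pol) : op (X + Y) f = op X f + op Y f := by
  simp only [op_apply, Fin.sum_univ_two, Matrix.toBlocks₁₁, Matrix.toBlocks₁₂, Matrix.toBlocks₂₁,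
    Matrix.toBlocks₂₂, Matrix.add_apply, Matrix.of_apply, add_smul]
  abel

theorem op_smul (c : ℂ) (X : GlAlg) (f : Pol) : op (c • X) f = c • op X f := by
  simp only [op_apply, Fin.sum_univ_two, Matrix.toBlocks₁₁, Matrix.toBlocks₁₂, Matrix.toBlocks₂₁,
    Matrix.toBlocks₂₂, Matrix.smul_apply, Matrix.of_apply, smul_eq_mul, mul_smul, smul_add, smul_sub,
    smul_neg]

theorem op_lop (i k : Fin 2) (c : ℂ) (f : Pol) :
    op (Matrix.fromBlocks (Matrix.single i k c) 0 0 0) f = -(c • lop i k f) := by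
  rw [op_apply]
  simp only [Matrix.toBlocks_fromBlocks₁₁, Matrix.toBlocks_fromBlocks₁₂,
    Matrix.toBlocks_fromBlocks₂₁, Matrix.toBlocks_fromBlocks₂₂]
  fin_cases i <;> fin_cases k <;> simp [Fin.sum_univ_two, Matrix.single]

theorem op_rop (i k : Fin 2) (c : ℂ) (f : Pol) :
    op (Matrix.fromBlocks 0 0 0 (Matrix.single i k c)) f = c • rop i k f := by
  rw [op_apply]
  simp only [Matrix.toBlocks_fromBlocks₁₁, Matrix.toBlocks_fromBlocks₁₂,
    Matrix.toBlocks_fromBlocks₂₁, Matrix.toBlocks_fromBlocks₂₂]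
  fin_cases i <;> fin_cases k <;> simp [Fin.sum_univ_two, Matrix.single]

theorem op_cop (i k : Fin 2) (c : ℂ) (f : Pol) :
    op (Matrix.fromBlocks 0 0 (Matrix.single i k c) 0) f = c • cop i k f := by
  rw [op_apply]
  simp only [Matrix.toBlocks_fromBlocks₁₁, Matrix.toBlocks_fromBlocks₁₂,
    Matrix.toBlocks_fromBlocks₂₁, Matrix.toBlocks_fromBlocks₂₂]
  fin_cases i <;> fin_cases k <;> simp [Fin.sum_univ_two, Matrix.single]

/-- `u(2,2)` is a real form of `gl(2, HC)`. -/
theorem exists_u22_add (X : GlAlg) : ∃ Y ∈ u22, ∃ Z ∈ u22, X = Y + Complex.I • Z := by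
  have hI : Complex.I * Complex.I = -1 := Complex.I_mul_I
  set A := X.toBlocks₁₁
  set B := X.toBlocks₁₂
  set C := X.toBlocks₂₁
  set D := X.toBlocks₂₂
  -- The parts (X - X†)/2 and (X + X†)/(2i), where X† has blocks A*, -C*, -B*, D* and is the adjoint
  -- for the Hermitian form of signature (2,2).
  refine ⟨Matrix.fromBlocks ((1 / 2 : ℂ) • (A - Aᴴ)) ((1 / 2 : ℂ) • (B + Cᴴ))
    ((1 / 2 : ℂ) • (B + Cᴴ))ᴴ ((1 / 2 : ℂ) • (D - Dᴴ)), ⟨_, _, _, ?_, ?_, rfl⟩,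
    Matrix.fromBlocks ((-Complex.I / 2) • (A + Aᴴ)) ((-Complex.I / 2) • (B - Cᴴ))
    ((-Complex.I / 2) • (B - Cᴴ))ᴴ ((-Complex.I / 2) • (D + Dᴴ)), ⟨_, _, _, ?_, ?_, rfl⟩, ?_⟩
  · ext i j; simp; ring
  · ext i j; simp; ring
  · ext i j; simp; ring
  · ext i j; simp; ring
  · rw [← Matrix.fromBlocks_toBlocks X, Matrix.fromBlocks_smul, Matrix.fromBlocks_add]
    congr 1 <;> ext i j <;> simp [A, B, C, D] <;> ring_nf <;> simp <;> ring

/-- The form is `u(2,2)`-invariant. -/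
theorem frm_op {X : GlAlg} (hX : X ∈ u22) {f g : Pol} (hf : f ∈ bh) (hg : g ∈ bh) :
    frm (op X f) g + frm f (op X g) = 0 := by
  obtain ⟨A, B, D, hA, hD, rfl⟩ := hX
  have hA' : ∀ i k, conj (A i k) = -A k i := fun i k => by
    conv_rhs => rw [hA]
    simp
  have hD' : ∀ i k, conj (D i k) = -D k i := fun i k => by
    conv_rhs => rw [hD]
    simp
  have hp : ∀ i j, frm (pd i j f) g = frm f (cop j i g) := fun i j => frm_pd i j f (box_box hf)
  have hc : ∀ i j, frm (cop j i f) g = frm f (pd i j g) := fun i j => frm_cop i j f (box_box hg)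
  simp only [op_apply, Matrix.toBlocks_fromBlocks₁₁, Matrix.toBlocks_fromBlocks₁₂,
    Matrix.toBlocks_fromBlocks₂₁, Matrix.toBlocks_fromBlocks₂₂, Fin.sum_univ_two, map_add, map_sub,
    map_neg, map_smul, map_smulₛₗ, LinearMap.add_apply, LinearMap.sub_apply, LinearMap.neg_apply,
    LinearMap.smul_apply, frm_lop, frm_rop, hp, hc, smul_eq_mul, hA', hD',
    Matrix.conjTranspose_apply, RCLike.star_def, Complex.conj_conj]
  ring

/-- The action of `gl(2, HC)` on the polynomial model of `BH⁺`. -/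
def opb (X : GlAlg) (f : bh) : bh := ⟨op X f, op_mem_bh X f.2⟩

/-! ### Uniqueness of the invariant form -/

theorem tP_one : tP 1 0 1 = zz 0 0 := by rw [tP_top, pow_one]

theorem zz_mem_bh : zz 0 0 ∈ bh := by
  rw [← tP_one]; exact tSpace_le_bh _ (tP_mem 1 0 1)

theorem dt_mem_bh : dt ∈ bh := by
  have h := dt_mul_mem_bh (tP_mem 0 0 0)
  rwa [tP_zero, mul_one] at h

/-- An invariant form makes X skew, so its eigenvectors for distinct imaginary eigenvalues are
orthogonal. The form need not be Hermitian. -/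
theorem eigen_orthogonal {b : Sesq bh}
    (hb : ∀ X ∈ u22, ∀ f g : bh, b (opb X f) g + b f (opb X g) = 0) {X : GlAlg} (hX : X ∈ u22)
    {f g : bh} {μ ν : ℝ} (hf : op X f = (-Complex.I * μ) • f.1) (hg : op X g = (-Complex.I * ν) • g.1)
    (h : μ ≠ ν) : b f g = 0 := by
  have h1 : opb X f = (-Complex.I * μ) • f := Subtype.ext hf
  have h2 : opb X g = (-Complex.I * ν) • g := Subtype.ext hg
  have h3 := hb X hX f g
  rw [h1, h2, map_smul, map_smulₛₗ, LinearMap.smul_apply] at h3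
  simp only [smul_eq_mul, map_mul, map_neg, Complex.conj_I, Complex.conj_ofReal] at h3
  have h4 : (-Complex.I * ((μ - ν : ℝ) : ℂ)) * b f g = 0 := by push_cast; linear_combination h3
  refine (mul_eq_zero.1 h4).resolve_left ?_
  refine mul_ne_zero (neg_ne_zero.2 Complex.I_ne_zero) ?_
  exact_mod_cast sub_ne_zero.2 h

/-- An invariant form that vanishes on the constants and at `z_00` is zero. -/
theorem invariant_eq_zero {b : Sesq bh}
    (hb : ∀ X ∈ u22, ∀ f g : bh, b (opb X f) g + b f (opb X g) = 0)
    (h1 : ∀ g, b ⟨1, one_mem_bh⟩ g = 0) (hz : b ⟨zz 0 0, zz_mem_bh⟩ ⟨zz 0 0, zz_mem_bh⟩ = 0) :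
    b = 0 := by
  -- The left radical of b, seen inside all polynomials. It is a complex subspace, so stability
  -- under u(2,2) extends to gl(2, HC).
  let S : Submodule ℂ Pol := (LinearMap.ker b).map bh.subtype
  have hS : ∀ f, f ∈ S ↔ ∃ h : f ∈ bh, ∀ g, b ⟨f, h⟩ g = 0 := fun f => by
    constructor
    · rintro ⟨f, hf, rfl⟩
      exact ⟨f.2, fun g => LinearMap.congr_fun (show b f = 0 from hf) g⟩
    · rintro ⟨h, hf⟩
      exact ⟨⟨f, h⟩, LinearMap.ext hf, rfl⟩
  have hu : ∀ X ∈ u22, ∀ f ∈ S, op X f ∈ S := fun X hX f hf => by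
    obtain ⟨h, hf⟩ := (hS f).1 hf
    refine (hS _).2 ⟨op_mem_bh X h, fun g => ?_⟩
    have := hb X hX ⟨f, h⟩ g
    rw [hf, add_zero] at this
    exact this
  have hX : ∀ X, ∀ f ∈ S, op X f ∈ S := fun X f hf => by
    obtain ⟨Y, hY, Z, hZ, rfl⟩ := exists_u22_add X
    rw [op_add, op_smul]
    exact add_mem (hu Y hY f hf) (Submodule.smul_mem _ _ (hu Z hZ f hf))
  have hl : ∀ i k, ∀ f ∈ S, lop i k f ∈ S := fun i k f hf => by
    simpa [op_lop] using hX (Matrix.fromBlocks (Matrix.single i k 1) 0 0 0) f hf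
  have hr : ∀ i k, ∀ f ∈ S, rop i k f ∈ S := fun i k f hf => by
    simpa [op_rop] using hX (Matrix.fromBlocks 0 0 0 (Matrix.single i k 1)) f hf
  have hc : ∀ i k, ∀ f ∈ S, cop i k f ∈ S := fun i k f hf => by
    simpa [op_cop] using hX (Matrix.fromBlocks 0 0 (Matrix.single i k 1) 0) f hf
  have ul : ∀ i, Matrix.fromBlocks (Matrix.single i i Complex.I) 0 0 0 ∈ u22 := fun i =>
    ⟨Matrix.single i i Complex.I, 0, 0, by
      fin_cases i <;> ext a b <;> fin_cases a <;> fin_cases b <;> simp [Matrix.single], by simp,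
      by simp⟩
  have ur : ∀ i, Matrix.fromBlocks 0 0 0 (Matrix.single i i (-Complex.I)) ∈ u22 := fun i =>
    ⟨0, 0, Matrix.single i i (-Complex.I), by simp,
      by
      fin_cases i <;> ext a b <;> fin_cases a <;> fin_cases b <;> simp [Matrix.single], by simp⟩
  -- The eigenvalues of `lop 0 0`, `lop 1 1` and `rop 0 0` are (b, a + c - b, a) on `tP a c b`; the
  -- factor `dt` adds 1 to each. Among these generators only z_00 itself has (1, 0, 1).
  have hzS : zz 0 0 ∈ S := by
    have z1 : lop 0 0 (zz 0 0) = ((1 : ℝ) : ℂ) • zz 0 0 := by simp [lop_apply, pd_zz]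
    have z2 : lop 1 1 (zz 0 0) = ((0 : ℝ) : ℂ) • zz 0 0 := by simp [lop_apply, pd_zz]
    have z3 : rop 0 0 (zz 0 0) = ((1 : ℝ) : ℂ) • zz 0 0 := by simp [rop_apply, pd_zz]
    have orl : ∀ i (g : bh) (μ ν : ℝ), lop i i (zz 0 0) = (μ : ℂ) • zz 0 0 →
        lop i i g = (ν : ℂ) • g.1 → μ ≠ ν → b ⟨zz 0 0, zz_mem_bh⟩ g = 0 := by
      intro i g μ ν h2 h3 h4
      refine eigen_orthogonal hb (ul i) (μ := μ) (ν := ν) ?_ ?_ h4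
      · rw [op_lop]; simp only [h2]; rw [smul_smul, neg_mul, neg_smul]
      · rw [op_lop, h3, smul_smul, neg_mul, neg_smul]
    have orr : ∀ i (g : bh) (μ ν : ℝ), rop i i (zz 0 0) = (μ : ℂ) • zz 0 0 →
        rop i i g = (ν : ℂ) • g.1 → μ ≠ ν → b ⟨zz 0 0, zz_mem_bh⟩ g = 0 := by
      intro i g μ ν h2 h3 h4
      refine eigen_orthogonal hb (ur i) (μ := μ) (ν := ν) ?_ ?_ h4
      · rw [op_rop]; simp only [h2]; rw [smul_smul]
      · rw [op_rop, h3, smul_smul]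
    have ht : ∀ a c β (h : tP a c β ∈ bh), b ⟨zz 0 0, zz_mem_bh⟩ ⟨tP a c β, h⟩ = 0 := by
      intro a c β h
      by_cases h2 : β = 1
      · by_cases h3 : a = 1
        · by_cases h4 : c = 0
          · subst h2 h3 h4
            simpa only [tP_one] using hz
          · refine orl 1 _ 0 (a + c - β) z2 (by push_cast; exact lop_one_one_tP a c β) ?_
            rw [h2, h3]; push_cast; simpa [eq_comm] using h4
        · refine orr 0 _ 1 a z3 (by push_cast; exact rop_zero_zero_tP a c β) ?_
          exact_mod_cast Ne.symm h3
      · refine orl 0 _ 1 β z1 (by push_cast; exact lop_zero_zero_tP a c β) ?_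
        exact_mod_cast Ne.symm h2
    have hN : ∀ a c β (h : dt * tP a c β ∈ bh), b ⟨zz 0 0, zz_mem_bh⟩ ⟨dt * tP a c β, h⟩ = 0 := by
      intro a c β h
      by_cases h2 : β = 0
      · refine orl 1 _ 0 (a + c + 1) z2 ?_ (by positivity)
        simp only [lop_dt, lop_one_one_tP, h2, if_true, mul_smul_comm]
        push_cast; rw [sub_zero, add_smul _ (1 : ℂ), one_smul]
      · refine orl 0 _ 1 (β + 1) z1 ?_ (by simpa using h2)
        simp only [lop_dt, lop_zero_zero_tP, if_true, mul_smul_comm]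
        push_cast; rw [add_smul, one_smul]
    refine (hS _).2 ⟨zz_mem_bh, fun g => ?_⟩
    obtain ⟨g, hg⟩ := g
    induction hg using Submodule.span_induction with
    | mem x hx =>
      obtain ⟨a, c, β, rfl | rfl⟩ := hx
      exacts [ht _ _ _ _, hN _ _ _ _]
    | zero => exact map_zero _
    | add x y hx hy h2 h3 =>
      have : (⟨x + y, add_mem hx hy⟩ : bh) = ⟨x, hx⟩ + ⟨y, hy⟩ := rfl
      rw [this, map_add, h2, h3, add_zero]
    | smul c x hx h2 =>
      have : (⟨c • x, Submodule.smul_mem _ c hx⟩ : bh) = c • ⟨x, hx⟩ := rfl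
      rw [this, map_smulₛₗ, h2, smul_zero]
  have hbS := bh_le_of_stable hl hr hc ((hS _).2 ⟨one_mem_bh, h1⟩) hzS
  ext f g
  obtain ⟨_, hf⟩ := (hS _).1 (hbS f.2)
  exact hf g

theorem fis_one_one : fis (fun _ => 1) 1 1 = 1 := by
  rw [← C_1, C_apply, fis_monomial]; simp [factor]

theorem frm_zz : frm (zz 0 0) (zz 0 0) = 1 := by
  have h := tP_mem 1 0 1
  rw [tP_one] at h
  rw [frm_tSpace h h]
  have := fis_pd (fun _ => 1) 0 0 (zz 0 0) 1
  rw [pd_zz, mul_one] at this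
  rw [← this]
  simp [fis_one_one, wt]

theorem frm_dt : frm dt dt = -2 := by
  have h := tP_mem 0 0 0
  rw [tP_zero] at h
  have := frm_dt_dt h h
  rw [mul_one, fis_one_one] at this
  rw [this]; simp [wt, Nat.factorial]

/-! ### Forms on a realization of the polynomial model -/

/-- The assertions of the theorem for one of the two spaces. -/
def HasInvariantForm (V : Submodule ℂ Fn) (hV : Stable V)
    (e₁ e₂ : (d : ℕ) → Fin (d + 1) → Fin (d + 1) → Fn) : Prop :=
  (∃ H : Sesq V,
      SphereFormula V e₁ e₂ H ∧
      IsHerm H ∧ IsIndefinite H ∧ Preserved (act hV) H ∧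
      (∀ f : V, (∀ g, H f g = 0) ↔ f.1 ∈ I0) ∧
      ∃ Q : Sesq (Quo V),
        (∀ f g : V, Q (Submodule.Quotient.mk f) (Submodule.Quotient.mk g) = H f g) ∧
        IsHerm Q ∧ IsIndefinite Q ∧ IsNondeg Q ∧ Preserved (qact hV) Q ∧
        (∀ B : Sesq (Quo V), IsHerm B → Preserved (qact hV) B →
          ∃ c : ℝ, ∀ x y, B x y = c * Q x y)) ∧
    (¬ ∃ B : Sesq (Quo V), IsHerm B ∧ IsPosDef B ∧ Preserved (qact hV) B)

/-- The multiple c would have to be positive because of one vector and negative because of another.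
-/
theorem not_posDef_of_unique {M : Type} [AddCommGroup M] [Module ℂ M] {α : GlAlg → M → M} {Q : Sesq M}
    (hQ : IsIndefinite Q)
    (h : ∀ B : Sesq M, IsHerm B → Preserved α B → ∃ c : ℝ, ∀ x y, B x y = c * Q x y) :
    ¬ ∃ B : Sesq M, IsHerm B ∧ IsPosDef B ∧ Preserved α B := by
  rintro ⟨B, hB, hpos, hinv⟩
  obtain ⟨c, hc⟩ := h B hB hinv
  obtain ⟨⟨x, hx⟩, y, hy⟩ := hQ
  have hx0 : x ≠ 0 := fun h => by simp [h] at hx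
  have hy0 : y ≠ 0 := fun h => by simp [h] at hy
  have h1 := hpos x hx0
  have h2 := hpos y hy0
  rw [hc, Complex.re_ofReal_mul] at h1 h2
  nlinarith

/-- A sesquilinear form that vanishes on a subspace in both variables descends to the quotient. -/
theorem exists_quotient_form {M : Type} [AddCommGroup M] [Module ℂ M] (p : Submodule ℂ M) (H : Sesq M)
    (h1 : ∀ x ∈ p, ∀ y, H x y = 0) (h2 : ∀ x, ∀ y ∈ p, H x y = 0) :
    ∃ Q : Sesq (M ⧸ p), ∀ f g : M, Q (Submodule.Quotient.mk f) (Submodule.Quotient.mk g) = H f g := by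
  let L : M →ₗ[ℂ] (M ⧸ p) →ₗ⋆[ℂ] ℂ :=
    { toFun := fun x => p.liftQ (H x) fun y hy => LinearMap.mem_ker.2 (h2 x y hy)
      map_add' := fun x y => by
        ext g; simp
      map_smul' := fun c x => by
        ext g; simp }
  refine ⟨p.liftQ L fun x hx => ?_, fun f g => rfl⟩
  rw [LinearMap.mem_ker]
  ext g
  exact h1 x hx g

/-- Converts the weight of `frm` and the factor (d + 1)! of `sphere_inner` into the coefficient
2l(2l+1) with 2l = d. -/
theorem wt_div (d : ℕ) : (wt d : ℂ) * (d + 1).factorial = d * (d + 1) := by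
  have h : (d.factorial : ℂ) ≠ 0 := by exact_mod_cast d.factorial_ne_zero
  simp only [wt, Nat.factorial_succ]; push_cast; field_simp

theorem wt_div_two (d : ℕ) :
    ((d : ℂ) + 1) * (d + 2) * (wt (d + 2) : ℂ) * (d + 1).factorial = (d + 2) * (d + 1) := by
  have h : (d.factorial : ℂ) ≠ 0 := by exact_mod_cast d.factorial_ne_zero
  have h2 : ((d : ℂ) + 2) ≠ 0 := by exact_mod_cast (d + 1).succ_ne_zero
  have h1 : ((d : ℂ) + 1) ≠ 0 := by exact_mod_cast d.succ_ne_zero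
  simp only [wt, Nat.factorial_succ]; push_cast
  rw [show (d : ℂ) + 1 + 1 = d + 2 by ring]
  field_simp

section Model

variable {e : Pol →ₗ[ℂ] Fn} {τ : GlAlg → GlAlg}
  {e₁ e₂ : (d : ℕ) → Fin (d + 1) → Fin (d + 1) → Fn}

theorem stable_map (hρ : ∀ X f, rho X (e f) = e (op (τ X) f)) : Stable (bh.map e) := by
  rintro X _ ⟨f, hf, rfl⟩
  rw [hρ]
  exact Submodule.mem_map_of_mem (op_mem_bh _ hf)

/-- Carries everything proved on `bh` to a realization e. The involution τ records how e twists the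
Lie algebra: the identity for `ev`, `swapBlocks` for `evInv`. -/
theorem hasInvariantForm_map (he : Function.Injective e) (h1 : e 1 = fun _ => 1)
    (hρ : ∀ X f, rho X (e f) = e (op (τ X) f))
    (hτ : ∀ X ∈ u22, τ X ∈ u22) (hττ : ∀ X, τ (τ X) = X)
    (he₁ : ∀ d a b, ∃ a' b' : Fin (d + 1), e₁ d a b = e (tP a' (d - a') b') ∧
      e₂ d a b = e (dt * tP a' (d - a') b'))
    (he₂ : ∀ d, ∀ a' b' : Fin (d + 1), ∃ a b, e₁ d a b = e (tP a' (d - a') b') ∧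
      e₂ d a b = e (dt * tP a' (d - a') b'))
    (hs : ∀ d d' f g, f ∈ tSpace d → g ∈ tSpace d' →
      sphInt (e f) (e g) * ((d + 1).factorial : ℂ) = 2 * Real.pi ^ 2 * fis (fun _ => 1) f g)
    (hs' : ∀ f g, sphInt (e (dt * f)) (e (dt * g)) = sphInt (e f) (e g))
    (hV : Stable (bh.map e)) : HasInvariantForm (bh.map e) hV e₁ e₂ := by
  let V := bh.map e
  let E : bh ≃ₗ[ℂ] V := Submodule.equivMapOfInjective e he bh
  have hE : ∀ f : bh, (E f).1 = e f.1 := fun f => rfl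
  have hact : ∀ X f, act hV X (E f) = E (opb (τ X) f) := fun X f => Subtype.ext (hρ X f)
  have hI0 : ∀ f : bh, (E f).1 ∈ I0 ↔ ∃ c, f.1 = C c := fun f => by
    rw [I0, Submodule.mem_span_singleton, hE, ← h1]
    refine exists_congr fun c => ?_
    rw [← map_smul, he.eq_iff, smul_eq_C_mul, mul_one, eq_comm]
  let H : Sesq V := LinearMap.mk₂'ₛₗ (RingHom.id ℂ) (starRingEnd ℂ)
    (fun x y => frm (E.symm x).1 (E.symm y).1) (fun _ _ _ => by simp) (fun _ _ _ => by simp)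
    (fun _ _ _ => by simp) (fun _ _ _ => by simp)
  have hH : ∀ f g : bh, H (E f) (E g) = frm f.1 g.1 := fun f g => by
    change frm (E.symm (E f)).1 (E.symm (E g)).1 = _
    rw [E.symm_apply_apply, E.symm_apply_apply]
  have hHe : ∀ (f g : Pol) (hf : f ∈ bh) (hg : g ∈ bh) (x y : V), x.1 = e f → y.1 = e g →
      H x y = frm f g := fun f g hf hg x y hx hy => by
    rw [show x = E ⟨f, hf⟩ from Subtype.ext hx, show y = E ⟨g, hg⟩ from Subtype.ext hy, hH]
  have herm : IsHerm H := fun x y => frm_herm _ _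
  have hker : ∀ f : V, (∀ g, H f g = 0) ↔ f.1 ∈ I0 := fun f => by
    obtain ⟨f, rfl⟩ := E.surjective f
    rw [hI0]
    constructor
    · intro h
      exact frm_kernel f.2 fun g hg => by rw [← hH f ⟨g, hg⟩]; exact h _
    · rintro ⟨c, hc⟩ g
      obtain ⟨g, rfl⟩ := E.surjective g
      rw [hH, hc, frm_C]
  obtain ⟨Q, hQ⟩ := exists_quotient_form (I0.submoduleOf V) H
    (fun x hx => (hker x).2 hx) (fun x y hy => by rw [herm, (hker y).2 hy, map_zero])
  have hmk := Submodule.Quotient.mk_surjective (I0.submoduleOf V)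
  have hpres : Preserved (act hV) H := fun X hX x y => by
    obtain ⟨f, rfl⟩ := E.surjective x
    obtain ⟨g, rfl⟩ := E.surjective y
    rw [hact, hact, hH, hH]
    exact frm_op (hτ X hX) f.2 g.2
  have hind : IsIndefinite H :=
    ⟨⟨E ⟨_, zz_mem_bh⟩, by rw [hH, frm_zz]; simp⟩, ⟨E ⟨_, dt_mem_bh⟩, by rw [hH, frm_dt]; simp⟩⟩
  have hindQ : IsIndefinite Q := by
    obtain ⟨⟨x, hx⟩, y, hy⟩ := hind
    exact ⟨⟨_, by rw [hQ]; exact hx⟩, ⟨_, by rw [hQ]; exact hy⟩⟩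
  have huniq : ∀ B : Sesq (Quo V), IsHerm B → Preserved (qact hV) B →
      ∃ c : ℝ, ∀ x y, B x y = c * Q x y := by
    intro B hB hBinv
    let q : bh →ₗ[ℂ] Quo V := (I0.submoduleOf V).mkQ ∘ₗ E.toLinearMap
    let z : bh := ⟨_, zz_mem_bh⟩
    -- Since `frm` takes the value 1 at z_00, the multiple must be the value of B there, which is
    -- real because B is Hermitian.
    have hc : (((B (q z) (q z)).re : ℝ) : ℂ) = B (q z) (q z) := Complex.conj_eq_iff_re.1 (hB _ _).symm
    let b : Sesq bh := LinearMap.mk₂'ₛₗ (RingHom.id ℂ) (starRingEnd ℂ)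
      (fun f g => B (q f) (q g) - (B (q z) (q z)).re * frm f.1 g.1)
      (fun _ _ _ => by simp; ring) (fun _ _ _ => by simp; ring)
      (fun _ _ _ => by simp; ring) (fun _ _ _ => by simp; ring)
    have hb : ∀ f g, b f g = B (q f) (q g) - (B (q z) (q z)).re * frm f.1 g.1 := fun f g => rfl
    have hqX : ∀ X f, q (opb X f) = qact hV (τ X) (q f) := fun X f => by
      change Submodule.Quotient.mk (E (opb X f)) = Submodule.Quotient.mk (act hV (τ X) (E f))
      rw [hact, hττ]
    have hb0 : b = 0 := by
      refine invariant_eq_zero ?_ ?_ ?_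
      · intro X hX f g
        have i1 := hBinv (τ X) (hτ X hX) (q f) (q g)
        have i2 := frm_op hX f.2 g.2
        rw [← hqX, ← hqX] at i1
        rw [hb, hb]
        change _ - _ * frm (op X f.1) g.1 + (_ - _ * frm f.1 (op X g.1)) = 0
        linear_combination i1 - ((B (q z) (q z)).re : ℂ) * i2
      · intro g
        have hq1 : q ⟨1, one_mem_bh⟩ = 0 :=
          (Submodule.Quotient.mk_eq_zero _).2 ((hI0 _).2 ⟨1, C_1.symm⟩)
        have := frm_C 1 g.1
        rw [C_1] at this
        rw [hb, hq1, this]; simp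
      · rw [hb, hc]
        change B (q z) (q z) - _ * frm (zz 0 0) (zz 0 0) = 0
        rw [frm_zz]; ring
    refine ⟨(B (q z) (q z)).re, fun x y => ?_⟩
    obtain ⟨x, rfl⟩ := hmk x
    obtain ⟨y, rfl⟩ := hmk y
    obtain ⟨f, rfl⟩ := E.surjective x
    obtain ⟨g, rfl⟩ := E.surjective y
    have : b f g = 0 := by rw [hb0]; rfl
    rw [hb, sub_eq_zero] at this
    rw [hQ, hH]
    exact this
  refine ⟨⟨H, ?_, herm, hind, hpres, hker, Q, hQ, ?_, hindQ, ?_, ?_, huniq⟩,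
    not_posDef_of_unique hindQ huniq⟩
  · have htb : ∀ d (a b : Fin (d + 1)), tP a (d - a) b ∈ tSpace d := fun d a b =>
      tP_mem' (by omega) b
    refine ⟨?_, ?_⟩
    · rw [bh, Submodule.map_span]
      apply le_antisymm
      · refine Submodule.span_mono ?_
        rintro f ⟨d, a, b, h⟩
        obtain ⟨a', b', h1, h2⟩ := he₁ d a b
        rcases h with rfl | rfl
        · exact ⟨_, ⟨_, _, _, Or.inl rfl⟩, h1.symm⟩
        · exact ⟨_, ⟨_, _, _, Or.inr rfl⟩, h2.symm⟩
      · refine Submodule.span_le.2 ?_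
        rintro _ ⟨_, ⟨a, c, b, h⟩, rfl⟩
        by_cases hb : b ≤ a + c
        · obtain ⟨a', b', h1, h2⟩ := he₂ (a + c) ⟨a, by omega⟩ ⟨b, by omega⟩
          simp only [Nat.add_sub_cancel_left] at h1 h2
          rcases h with rfl | rfl
          · exact Submodule.subset_span ⟨_, a', b', Or.inl h1.symm⟩
          · exact Submodule.subset_span ⟨_, a', b', Or.inr h2.symm⟩
        -- The generators of `bh` allow any b, but those with b > a + c are zero.
        · rw [tP_eq_zero (by omega), mul_zero, or_self] at h
          rw [h, map_zero]; exact zero_mem _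
    · have hm₁ : ∀ d a b, e₁ d a b ∈ V := fun d a b => by
        obtain ⟨a', b', h1, -⟩ := he₁ d a b
        rw [h1]; exact Submodule.mem_map_of_mem (tSpace_le_bh _ (htb d a' b'))
      have hm₂ : ∀ d a b, e₂ d a b ∈ V := fun d a b => by
        obtain ⟨a', b', -, h2⟩ := he₁ d a b
        rw [h2]; exact Submodule.mem_map_of_mem (dt_mul_mem_bh (htb d a' b'))
      refine ⟨hm₁, hm₂, fun d a b d' a' b' => ?_⟩
      obtain ⟨α, β, h1, h2⟩ := he₁ d a b
      obtain ⟨α', β', h1', h2'⟩ := he₁ d' a' b'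
      have t1 := htb d α β
      have t2 := htb d' α' β'
      have s1 := tSpace_le_bh _ t1
      have s2 := tSpace_le_bh _ t2
      have u1 := dt_mul_mem_bh t1
      have u2 := dt_mul_mem_bh t2
      have hS := hs d d' _ _ t1 t2
      have hfac : ((d + 1).factorial : ℂ) ≠ 0 := by exact_mod_cast (d + 1).factorial_ne_zero
      have hpi : (Real.pi : ℂ) ≠ 0 := by exact_mod_cast Real.pi_ne_zero
      refine ⟨?_, ?_, ?_, ?_⟩
      · rw [hHe _ _ s1 s2 _ _ h1 h1', frm_tSpace t1 t2, h1, h1', div_mul_eq_mul_div, eq_div_iff (by simp)]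
        refine mul_right_cancel₀ hfac ?_
        linear_combination (2 * Real.pi ^ 2 * fis (fun _ => 1) (tP α (d - α) β) (tP α' (d' - α') β')) *
          wt_div d - (d : ℂ) * (d + 1) * hS
      · rw [hHe _ _ u1 u2 _ _ h2 h2', frm_dt_dt t1 t2, h2, h2', hs', div_mul_eq_mul_div, eq_div_iff (by simp)]
        refine mul_right_cancel₀ hfac ?_
        linear_combination (-2 * Real.pi ^ 2 * fis (fun _ => 1) (tP α (d - α) β) (tP α' (d' - α') β')) *
          wt_div_two d + ((d : ℂ) + 2) * (d + 1) * hS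
      · rw [hHe _ _ s1 u2 _ _ h1 h2', frm_tSpace_dt t1]
      · rw [hHe _ _ u1 s2 _ _ h2 h1', frm_dt_tSpace t2]
  · intro x y
    obtain ⟨x, rfl⟩ := hmk x
    obtain ⟨y, rfl⟩ := hmk y
    rw [hQ, hQ]; exact herm x y
  · intro x h
    obtain ⟨x, rfl⟩ := hmk x
    exact (Submodule.Quotient.mk_eq_zero _).2 ((hker x).1 fun g => by rw [← hQ]; exact h _)
  · intro X hX x y
    obtain ⟨x, rfl⟩ := hmk x
    obtain ⟨y, rfl⟩ := hmk y
    change Q (Submodule.Quotient.mk (act hV X x)) _ + Q _ (Submodule.Quotient.mk (act hV X y)) = 0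
    rw [hQ, hQ]; exact hpres X hX x y

end Model

/-! ### Derivatives of matrix-valued functions -/

/-- Entrywise derivative at `0` of a matrix-valued function. -/
def MatDeriv (γ : ℝ → HC) (γ' : HC) : Prop := ∀ i j, HasDerivAt (fun t => γ t i j) (γ' i j) 0

theorem MatDeriv.add {γ δ : ℝ → HC} {γ' δ' : HC} (h : MatDeriv γ γ') (h' : MatDeriv δ δ') :
    MatDeriv (fun t => γ t + δ t) (γ' + δ') := fun i j => (h i j).add (h' i j)

theorem MatDeriv.const (A : HC) : MatDeriv (fun _ => A) 0 := fun _ _ => hasDerivAt_const _ _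

theorem MatDeriv.mul {γ δ : ℝ → HC} {γ' δ' : HC} (h : MatDeriv γ γ') (h' : MatDeriv δ δ') :
    MatDeriv (fun t => γ t * δ t) (γ' * δ 0 + γ 0 * δ') := fun i j => by
  have := HasDerivAt.fun_sum (u := Finset.univ) fun k _ => (h i k).mul (h' k j)
  simp only [Matrix.mul_apply, Matrix.add_apply, ← Finset.sum_add_distrib]
  exact this

theorem MatDeriv.inv {γ : ℝ → HC} {γ' : HC} (h : MatDeriv γ γ') (h0 : IsUnit (γ 0)) :
    MatDeriv (fun t => (γ t)⁻¹) (-((γ 0)⁻¹ * γ' * (γ 0)⁻¹)) := by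
  have hdet : (γ 0).det ≠ 0 := ((Matrix.isUnit_iff_isUnit_det _).1 h0).ne_zero
  have hdd : DifferentiableAt ℝ (fun t => (γ t).det) 0 := by
    simp only [Matrix.det_fin_two]
    exact ((h 0 0).differentiableAt.mul (h 1 1).differentiableAt).sub
      ((h 0 1).differentiableAt.mul (h 1 0).differentiableAt)
  have hda : ∀ i j, DifferentiableAt ℝ (fun t => (γ t).adjugate i j) 0 := by
    intro i j
    simp only [Matrix.adjugate_fin_two]
    fin_cases i <;> fin_cases j <;> simp
    exacts [(h 1 1).differentiableAt, (h 0 1).differentiableAt, (h 1 0).differentiableAt,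
      (h 0 0).differentiableAt]
  have hd : ∀ i j, DifferentiableAt ℝ (fun t => (γ t)⁻¹ i j) 0 := by
    intro i j
    simp only [Matrix.inv_def, Ring.inverse_eq_inv', Matrix.smul_apply, smul_eq_mul]
    exact (hdd.inv hdet).mul (hda i j)
  obtain ⟨δ, hδ⟩ : ∃ δ, MatDeriv (fun t => (γ t)⁻¹) δ :=
    ⟨Matrix.of fun i j => deriv (fun t => (γ t)⁻¹ i j) 0, fun i j => (hd i j).hasDerivAt⟩
  -- Cramer's rule gave differentiability only. The value of the derivative is forced by
  -- differentiating γ γ⁻¹ = 1, which holds near 0.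
  have h1 : γ' * (γ 0)⁻¹ + γ 0 * δ = 0 := by
    ext i j
    refine (h.mul hδ i j).unique ((hasDerivAt_const (0 : ℝ) ((1 : HC) i j)).congr_of_eventuallyEq ?_)
    filter_upwards [hdd.continuousAt.eventually_ne hdet] with t ht
    rw [Matrix.mul_nonsing_inv _ (isUnit_iff_ne_zero.2 ht)]
  have h2 : δ = -((γ 0)⁻¹ * γ' * (γ 0)⁻¹) := by
    have := congrArg (fun M => (γ 0)⁻¹ * M) h1
    simp only [mul_add, mul_zero, ← mul_assoc,
      Matrix.nonsing_inv_mul _ (isUnit_iff_ne_zero.2 hdet), one_mul] at this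
    exact (neg_eq_of_add_eq_zero_right this).symm
  rwa [← h2]

/-- The value of a polynomial at a matrix. -/
def evM (M : HC) : Pol →ₐ[ℂ] ℂ := aeval fun p : Fin 2 × Fin 2 => M p.1 p.2

theorem evM_zz (M : HC) (i j : Fin 2) : evM M (zz i j) = M i j := by simp [evM, zz]

theorem evM_C (M : HC) (c : ℂ) : evM M (C c) = c := by simp [evM]

theorem MatDeriv.hasDerivAt_evM {γ : ℝ → HC} {γ' : HC} (h : MatDeriv γ γ') (f : Pol) :
    HasDerivAt (fun t => evM (γ t) f) (∑ i, ∑ j, γ' i j * evM (γ 0) (pd i j f)) 0 := by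
  induction f using MvPolynomial.induction_on with
  | C c => simpa [evM_C, pd_C] using hasDerivAt_const (0 : ℝ) c
  | add p q hp hq =>
    simp only [map_add, mul_add, Finset.sum_add_distrib]
    exact hp.add hq
  | mul_X p x hp =>
    obtain ⟨k, l⟩ := x
    change HasDerivAt (fun t => evM (γ t) (p * zz k l))
      (∑ i, ∑ j, γ' i j * evM (γ 0) (pd i j (p * zz k l))) 0
    simp only [map_mul, evM_zz]
    refine (hp.mul (h k l)).congr_deriv ?_
    simp only [pd_mul, map_add, map_mul, evM_zz, pd_zz]
    simp only [Fin.sum_univ_two]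
    fin_cases k <;> fin_cases l <;> simp <;> ring

theorem hasDerivAt_exp_entry (X : GlAlg) (i j : Fin 2 ⊕ Fin 2) :
    HasDerivAt (fun t : ℝ => NormedSpace.exp (-(t • X)) i j) (-X i j) 0 := by
  let _ : SeminormedRing GlAlg := Matrix.linftyOpSemiNormedRing
  let _ : NormedRing GlAlg := Matrix.linftyOpNormedRing
  let _ : NormedAlgebra ℝ GlAlg := Matrix.linftyOpNormedAlgebra
  let _ : NormedAlgebra ℚ GlAlg := NormedAlgebra.restrictScalars ℚ ℝ GlAlg
  have h := hasDerivAt_exp_smul_const (𝕂 := ℝ) (-X) (0 : ℝ)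
  have h2 := (Matrix.entryLinearMap ℝ ℂ i j).toContinuousLinearMap.hasFDerivAt.comp_hasDerivAt
    (0 : ℝ) h
  rw [show -X i j = (NormedSpace.exp ((0 : ℝ) • -X) * -X) i j by
    rw [zero_smul, NormedSpace.exp_zero, one_mul]; rfl]
  simp only [← smul_neg]
  exact h2

/-- Product rule at the identity. The numerator carries the minus sign of exp(-tX); inverting the
denominator reverses it, hence the opposite sign of the second term. -/
theorem matDeriv_moebius (X : GlAlg) (Z : HC) :
    MatDeriv (fun t : ℝ => moebius (NormedSpace.exp (-(t • X))) Z)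
      (-(X.toBlocks₁₁ * Z + X.toBlocks₁₂) + Z * (X.toBlocks₂₁ * Z + X.toBlocks₂₂)) := by
  have h0 : NormedSpace.exp (-((0 : ℝ) • X)) = Matrix.fromBlocks 1 0 0 1 := by
    simp [Matrix.fromBlocks_one]
  have h11 : MatDeriv (fun t => (NormedSpace.exp (-(t • X))).toBlocks₁₁) (-X.toBlocks₁₁) :=
    fun i j => hasDerivAt_exp_entry X (.inl i) (.inl j)
  have h12 : MatDeriv (fun t => (NormedSpace.exp (-(t • X))).toBlocks₁₂) (-X.toBlocks₁₂) :=
    fun i j => hasDerivAt_exp_entry X (.inl i) (.inr j)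
  have h21 : MatDeriv (fun t => (NormedSpace.exp (-(t • X))).toBlocks₂₁) (-X.toBlocks₂₁) :=
    fun i j => hasDerivAt_exp_entry X (.inr i) (.inl j)
  have h22 : MatDeriv (fun t => (NormedSpace.exp (-(t • X))).toBlocks₂₂) (-X.toBlocks₂₂) :=
    fun i j => hasDerivAt_exp_entry X (.inr i) (.inr j)
  have hp := (h11.mul (MatDeriv.const Z)).add h12
  have hq := (h21.mul (MatDeriv.const Z)).add h22
  have h := hp.mul (hq.inv (by
    simp only [h0, Matrix.toBlocks_fromBlocks₂₁, Matrix.toBlocks_fromBlocks₂₂]; simp))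
  simp only [h0, Matrix.toBlocks_fromBlocks₁₁, Matrix.toBlocks_fromBlocks₁₂,
    Matrix.toBlocks_fromBlocks₂₁, Matrix.toBlocks_fromBlocks₂₂] at h
  refine fun i j => (h i j).congr_deriv ?_
  refine congrFun (congrFun ?_ i) j
  simp
  noncomm_ring

theorem moebius_zero (X : GlAlg) (Z : HC) : moebius (NormedSpace.exp (-((0 : ℝ) • X))) Z = Z := by
  have h0 : NormedSpace.exp (-((0 : ℝ) • X)) = Matrix.fromBlocks 1 0 0 1 := by
    simp [Matrix.fromBlocks_one]
  simp only [moebius, h0, Matrix.toBlocks_fromBlocks₁₁, Matrix.toBlocks_fromBlocks₁₂,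
    Matrix.toBlocks_fromBlocks₂₁, Matrix.toBlocks_fromBlocks₂₂]
  simp

theorem extZ_val (f : Fn) (u : HCx) : extZ f (u : HC) = f u :=
  Function.Injective.extend_apply (fun _ _ h => Units.ext h) f 0 u

theorem evM_op (X : GlAlg) (Z : HC) (f : Pol) : evM Z (op X f) =
    ∑ i, ∑ j, (-(X.toBlocks₁₁ * Z + X.toBlocks₁₂) + Z * (X.toBlocks₂₁ * Z + X.toBlocks₂₂)) i j *
      evM Z (pd i j f) := by
  simp only [op_apply, lop_apply, rop_apply, cop_apply, Fin.sum_univ_two, map_add, map_sub, map_neg,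
    map_smul, map_mul, evM_zz, smul_eq_mul, Matrix.add_apply, Matrix.neg_apply, Matrix.mul_apply]
  ring

/-! ### The two realizations -/

/-- Polynomials as functions on the invertible matrices. -/
def ev : Pol →ₗ[ℂ] Fn := LinearMap.pi fun Z => (evM Z.val).toLinearMap

/-- Polynomials in the entries of the inverse matrix. -/
def evInv : Pol →ₗ[ℂ] Fn := LinearMap.pi fun Z => (evM (Z⁻¹).val).toLinearMap

theorem ev_apply (f : Pol) (Z : HCx) : ev f Z = evM Z.val f := rfl

theorem evInv_apply (f : Pol) (Z : HCx) : evInv f Z = evM (Z⁻¹).val f := rfl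

theorem rho_ev (X : GlAlg) (f : Pol) : rho X (ev f) = ev (op X f) := by
  funext Z
  have h := (matDeriv_moebius X Z.val).hasDerivAt_evM f
  rw [moebius_zero, ← evM_op] at h
  rw [rho, ev_apply, ← h.deriv]
  refine Filter.EventuallyEq.deriv_eq ?_
  filter_upwards [eventually_isUnit X Z] with t ht
  obtain ⟨u, hu⟩ := ht
  rw [← hu, extZ_val, ev_apply]

/-- Conjugation by the block matrix `(0 1; 1 0)`. -/
def swapBlocks (X : GlAlg) : GlAlg :=
  Matrix.fromBlocks X.toBlocks₂₂ X.toBlocks₂₁ X.toBlocks₁₂ X.toBlocks₁₁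

theorem swapBlocks_swapBlocks (X : GlAlg) : swapBlocks (swapBlocks X) = X := by
  simp [swapBlocks, Matrix.fromBlocks_toBlocks]

theorem swapBlocks_mem {X : GlAlg} (hX : X ∈ u22) : swapBlocks X ∈ u22 := by
  obtain ⟨A, B, D, hA, hD, rfl⟩ := hX
  exact ⟨D, Bᴴ, A, hD, hA, by simp [swapBlocks]⟩

/-- Inversion is the fractional linear map of (0 1; 1 0), so it conjugates the action by that
matrix. The infinitesimal form of this is the identity `e`. -/
theorem rho_evInv (X : GlAlg) (f : Pol) : rho X (evInv f) = evInv (op (swapBlocks X) f) := by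
  funext Z
  have hZ : IsUnit (moebius (NormedSpace.exp (-((0 : ℝ) • X))) Z.val) := by
    rw [moebius_zero]; exact Z.isUnit
  have h := ((matDeriv_moebius X Z.val).inv hZ).hasDerivAt_evM f
  have hi : (Z⁻¹).val = (Z.val)⁻¹ := Matrix.coe_units_inv Z
  have hZ1 : Z.val⁻¹ * Z.val = 1 := by rw [← hi]; exact Z.inv_mul
  have hZ2 : Z.val * Z.val⁻¹ = 1 := by rw [← hi]; exact Z.mul_inv
  have e : -(Z.val⁻¹ * (-(X.toBlocks₁₁ * Z.val + X.toBlocks₁₂) +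
        Z.val * (X.toBlocks₂₁ * Z.val + X.toBlocks₂₂)) * Z.val⁻¹) =
      -(X.toBlocks₂₂ * Z.val⁻¹ + X.toBlocks₂₁) +
        Z.val⁻¹ * (X.toBlocks₁₂ * Z.val⁻¹ + X.toBlocks₁₁) := by
    have e1 : Z.val⁻¹ * (X.toBlocks₁₁ * Z.val) * Z.val⁻¹ = Z.val⁻¹ * X.toBlocks₁₁ := by
      rw [mul_assoc, mul_assoc, hZ2, mul_one]
    have e2 : Z.val⁻¹ * (Z.val * (X.toBlocks₂₁ * Z.val)) * Z.val⁻¹ = X.toBlocks₂₁ := by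
      rw [← mul_assoc, hZ1, one_mul, mul_assoc, hZ2, mul_one]
    have e3 : Z.val⁻¹ * (Z.val * X.toBlocks₂₂) * Z.val⁻¹ = X.toBlocks₂₂ * Z.val⁻¹ := by
      rw [← mul_assoc, hZ1, one_mul]
    simp only [mul_add, add_mul, mul_neg, neg_mul, e1, e2, e3]
    rw [mul_assoc Z.val⁻¹ X.toBlocks₁₂]
    abel
  rw [moebius_zero, e] at h
  rw [rho, evInv_apply, evM_op, hi]
  simp only [swapBlocks, Matrix.toBlocks_fromBlocks₁₁, Matrix.toBlocks_fromBlocks₁₂,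
    Matrix.toBlocks_fromBlocks₂₁, Matrix.toBlocks_fromBlocks₂₂]
  rw [← h.deriv]
  refine Filter.EventuallyEq.deriv_eq ?_
  filter_upwards [eventually_isUnit X Z] with t ht
  obtain ⟨u, hu⟩ := ht
  rw [← hu, extZ_val, evInv_apply, Matrix.coe_units_inv]

/-- Multiplying by `dt` makes the polynomial vanish at singular matrices too; then `dt * f` is zero,
and `dt` can be cancelled since `frm dt dt = -2`. -/
theorem eq_zero_of_ev {f : Pol} (h : ∀ Z : HCx, evM Z.val f = 0) : f = 0 := by
  have h1 : dt * f = 0 := by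
    refine MvPolynomial.funext fun v => ?_
    have hv : ∀ g : Pol, eval v g = evM (Matrix.of fun i j => v (i, j)) g := fun g => by
      rfl
    rw [hv, map_mul, map_zero]
    by_cases hd : (Matrix.of fun i j => v (i, j)).det = 0
    · have : evM (Matrix.of fun i j => v (i, j)) dt = 0 := by
        rw [← hd, Matrix.det_fin_two]; simp [dt, evM_zz]
      rw [this, zero_mul]
    · have := h (Matrix.GeneralLinearGroup.mkOfDetNeZero _ hd)
      rw [show (Matrix.GeneralLinearGroup.mkOfDetNeZero _ hd).val = Matrix.of fun i j => v (i, j)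
        from rfl] at this
      rw [this, mul_zero]
  refine (mul_eq_zero.1 h1).resolve_left fun h2 => ?_
  have := frm_dt
  rw [h2] at this
  simp at this

theorem ev_injective : Function.Injective ev :=
  (injective_iff_map_eq_zero _).2 fun _ h => eq_zero_of_ev fun Z => congrFun h Z

theorem evInv_injective : Function.Injective evInv :=
  (injective_iff_map_eq_zero _).2 fun f h => eq_zero_of_ev fun Z => by
    have := congrFun h Z⁻¹
    rwa [evInv_apply, inv_inv] at this

theorem evM_dt (M : HC) : evM M dt = M.det := by
  rw [Matrix.det_fin_two]; simp [dt, evM_zz]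

/-! ### Contour integrals -/

/-- Of the powers of s in the integrand only s⁻¹ has a nonzero integral over the circle. -/
theorem contour_coeff (p : Polynomial ℂ) (b : ℕ) :
    (2 * Real.pi * Complex.I)⁻¹ * ∮ s in C(0, 1), p.eval s * s ^ (-(b : ℤ)) / s = p.coeff b := by
  have h2 : (2 * Real.pi * Complex.I : ℂ) ≠ 0 := by simp [Real.pi_ne_zero]
  have hint : ∀ k : ℕ, ∀ c : ℂ, CircleIntegrable (fun s : ℂ => c * s ^ ((k : ℤ) - b - 1)) 0 1 := by
    intro k c
    apply ContinuousOn.circleIntegrable zero_le_one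
    refine continuousOn_const.mul (ContinuousOn.zpow₀ continuousOn_id _ fun s hs => Or.inl ?_)
    rintro rfl
    simp at hs
  have h : (∮ s in C(0, 1), p.eval s * s ^ (-(b : ℤ)) / s) =
      ∮ s in C(0, 1), ∑ k ∈ p.support, p.coeff k * s ^ ((k : ℤ) - b - 1) := by
    refine circleIntegral.integral_congr zero_le_one fun s hs => ?_
    have hs0 : s ≠ 0 := by rintro rfl; simp at hs
    simp only [Polynomial.eval_eq_sum, Polynomial.sum_def, Finset.sum_mul, Finset.sum_div]
    refine Finset.sum_congr rfl fun k _ => ?_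
    rw [zpow_sub₀ hs0, zpow_sub₀ hs0, zpow_neg, zpow_natCast, zpow_one]
    rw [zpow_natCast]; field_simp
  rw [h, circleIntegral.integral_fun_sum fun k _ => hint k _]
  have hk : ∀ k : ℕ, (∮ s in C(0, 1), p.coeff k * s ^ ((k : ℤ) - b - 1)) =
      if k = b then p.coeff k * (2 * Real.pi * Complex.I) else 0 := by
    intro k
    rw [circleIntegral.integral_const_mul]
    split_ifs with hkb
    · subst hkb
      have := circleIntegral.integral_sub_center_inv (0 : ℂ) (one_ne_zero : (1 : ℝ) ≠ 0)
      rw [← this]; simp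
    · have := circleIntegral.integral_sub_zpow_of_ne (n := (k : ℤ) - b - 1) (by omega) (0 : ℂ) 0 1
      simp only [sub_zero] at this
      rw [this, mul_zero]
  simp only [hk]
  rw [Finset.sum_ite_eq' p.support b]
  split_ifs with hb
  · field_simp
  · rw [Polynomial.notMem_support_iff.1 hb, mul_zero]

theorem tFun_eq (d : ℕ) (a b : Fin (d + 1)) : tFun d a b = ev (tP a (d - a) b) := by
  funext Z
  rw [ev_apply, tP, ← AlgHom.coe_toRingHom, ← Polynomial.coeff_map, ← contour_coeff, tFun]
  congr 2
  funext s
  congr 2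
  simp [gen, colF, colG, evM_zz, mul_comm s]

/-! ### Passage to the adjugate matrix -/

/-- The substitution of the adjugate matrix. -/
def adjS : Pol →ₐ[ℂ] Pol := aeval fun x => C (sgn x.1 x.2) * zz (1 - x.2) (1 - x.1)

theorem adjS_zz (i j : Fin 2) : adjS (zz i j) = C (sgn i j) * zz (1 - j) (1 - i) := by
  simp [adjS, zz]

theorem adjS_C (c : ℂ) : adjS (C c) = C c := by simp [adjS]

theorem adjS_adjS (f : Pol) : adjS (adjS f) = f := by
  have : adjS.comp adjS = AlgHom.id ℂ Pol := by
    refine MvPolynomial.algHom_ext fun x => ?_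
    obtain ⟨i, j⟩ := x
    change adjS (adjS (zz i j)) = zz i j
    rw [adjS_zz, map_mul, adjS_zz, adjS_C]
    fin_cases i <;> fin_cases j <;> simp [sgn]
  exact AlgHom.congr_fun this f

theorem evM_adjugate (M : HC) (f : Pol) : evM M.adjugate f = evM M (adjS f) := by
  have : evM M.adjugate = (evM M).comp adjS := by
    refine MvPolynomial.algHom_ext fun x => ?_
    obtain ⟨i, j⟩ := x
    change evM M.adjugate (zz i j) = evM M (adjS (zz i j))
    rw [adjS_zz, map_mul, evM_zz, evM_zz, evM_C, Matrix.adjugate_fin_two]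
    fin_cases i <;> fin_cases j <;> simp [sgn]
  exact AlgHom.congr_fun this f

theorem pd_adjS (i j : Fin 2) (f : Pol) :
    pd i j (adjS f) = C (sgn i j) * adjS (pd (1 - j) (1 - i) f) := by
  induction f using MvPolynomial.induction_on with
  | C c => rw [adjS_C, pd_C, pd_C, map_zero, mul_zero]
  | add p q hp hq => simp [hp, hq, mul_add]
  | mul_X p x hp =>
    obtain ⟨k, l⟩ := x
    change pd i j (adjS (p * zz k l)) = C (sgn i j) * adjS (pd (1 - j) (1 - i) (p * zz k l))
    rw [map_mul, pd_mul, hp, pd_mul, map_add, map_mul, map_mul, adjS_zz, pd_mul, pd_C, pd_zz, pd_zz]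
    fin_cases i <;> fin_cases j <;> fin_cases k <;> fin_cases l <;> simp [sgn] <;> ring

theorem adjS_lop (f : Pol) : adjS (lop 0 1 f) = -rop 0 1 (adjS f) := by
  simp [lop_apply, rop_apply, adjS_zz, pd_adjS, sgn]

theorem adjS_rop (f : Pol) : adjS (rop 1 0 f) = -lop 1 0 (adjS f) := by
  simp [lop_apply, rop_apply, adjS_zz, pd_adjS, sgn]

/-- The adjugate reverses products, so it exchanges left and right multiplication fields up to sign.
It sends z_00^d to z_11^d, again a matrix coefficient, and generation from z_00^d does the rest. -/
theorem adjS_mem {d : ℕ} {f : Pol} (hf : f ∈ tSpace d) : adjS f ∈ tSpace d := by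
  refine tSpace_le_of_stable (S := (tSpace d).comap adjS.toLinearMap) ?_ ?_ ?_ hf
  · intro f hf
    change adjS (lop 0 1 f) ∈ tSpace d
    rw [adjS_lop]; exact neg_mem (rop_mem hf 0 1)
  · intro f hf
    change adjS (rop 1 0 f) ∈ tSpace d
    rw [adjS_rop]; exact neg_mem (lop_mem hf 1 0)
  · change adjS (zz 0 0 ^ d) ∈ tSpace d
    rw [map_pow, adjS_zz, sgn_zz, C_1, one_mul, sub_zero, ← tP_bot]
    exact tP_mem' (zero_add d) 0

/-- The adjugate permutes the variables up to signs, which preserves the unweighted Fischer product.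
-/
theorem fis_adjS (f : Pol) : ∀ g, fis (fun _ => 1) (adjS f) (adjS g) = fis (fun _ => 1) f g := by
  induction f using MvPolynomial.induction_on with
  | C c =>
    intro g
    have : coeff 0 (adjS g) = coeff 0 g := by
      induction g using MvPolynomial.induction_on with
      | C c => rw [adjS_C]
      | add p q hp hq => simp [hp, hq]
      | mul_X p x hp =>
        have : adjS (X x) = _ := adjS_zz x.1 x.2
        rw [map_mul, this]
        simp [← constantCoeff_eq, zz]
    rw [adjS_C, C_apply, fis_monomial, fis_monomial, this]
  | add p q hp hq => intro g; simp [hp, hq]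
  | mul_X p x hp =>
    intro g
    obtain ⟨i, j⟩ := x
    change fis (fun _ => 1) (adjS (p * zz i j)) (adjS g) = fis (fun _ => 1) (p * zz i j) g
    rw [mul_comm, fis_mul_shift, ← hp, map_mul, adjS_zz, mul_assoc, ← smul_eq_C_mul, map_smul,
      LinearMap.smul_apply, fis_mul_shift, pd_adjS, ← smul_eq_C_mul, map_smulₛₗ]
    fin_cases i <;> fin_cases j <;> simp [sgn]

theorem evM_smul {d : ℕ} {f : Pol} (hf : f ∈ tSpace d) (c : ℂ) (M : HC) :
    evM (c • M) f = c ^ d * evM M f := by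
  rw [evM, evM, aeval_def, aeval_def, eval₂_eq', eval₂_eq', Finset.mul_sum]
  refine Finset.sum_congr rfl fun α hα => ?_
  have h := congrArg (coeff α) (eul_eq hf)
  rw [coeff_eul, coeff_smul, smul_eq_mul] at h
  have hd : α.degree = d := by exact_mod_cast mul_right_cancel₀ (mem_support_iff.1 hα) h
  simp only [Matrix.smul_apply, smul_eq_mul, mul_pow, Finset.prod_mul_distrib,
    Finset.prod_pow_eq_pow_sum]
  rw [← Finsupp.degree_eq_sum, hd]; ring

theorem evInv_eq {d : ℕ} {f : Pol} (hf : f ∈ tSpace d) (Z : HCx) :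
    evInv f Z = nrm Z ^ (-(d : ℤ)) * ev (adjS f) Z := by
  rw [evInv_apply, Matrix.coe_units_inv, Matrix.inv_def, evM_smul hf, evM_adjugate,
    Ring.inverse_eq_inv', ev_apply, nrm, zpow_neg, zpow_natCast, inv_pow]

theorem nrm_ne_zero (Z : HCx) : nrm Z ≠ 0 :=
  ((Matrix.isUnit_iff_isUnit_det _).1 Z.isUnit).ne_zero

theorem ev_dt_mul (f : Pol) (Z : HCx) : ev (dt * f) Z = nrm Z * ev f Z := by
  rw [ev_apply, map_mul, evM_dt]; rfl

theorem evInv_dt_mul (f : Pol) (Z : HCx) : evInv (dt * f) Z = (nrm Z)⁻¹ * evInv f Z := by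
  rw [evInv_apply, map_mul, evM_dt, Matrix.coe_units_inv, Matrix.det_nonsing_inv,
    Ring.inverse_eq_inv', evInv_apply, Matrix.coe_units_inv]; rfl

/-! ### Identification of the two spaces -/

theorem tSpace_le_fin {d : ℕ} {S : Submodule ℂ Pol}
    (h : ∀ a b : Fin (d + 1), tP a (d - a) b ∈ S) : tSpace d ≤ S := by
  refine Submodule.span_le.2 ?_
  rintro _ ⟨a, c, b, rfl, rfl⟩
  by_cases hb : b ≤ a + c
  · simpa using h ⟨a, by omega⟩ ⟨b, by omega⟩
  · rw [tP_eq_zero (by omega)]; exact zero_mem _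

theorem tP_fin_mem (d : ℕ) (a b : Fin (d + 1)) : tP a (d - a) b ∈ tSpace d :=
  tP_mem' (by omega) b

theorem nrm_zpow_mul_mem {d : ℕ} {f : Pol} (hf : f ∈ tSpace d) (k : ℤ) {V : Submodule ℂ Fn}
    (hV : ∀ a b : Fin (d + 1), (fun Z => nrm Z ^ k * tFun d a b Z) ∈ V) :
    (fun Z => nrm Z ^ k * ev f Z) ∈ V := by
  have : tSpace d ≤ V.comap (LinearMap.mulLeft ℂ (fun Z => nrm Z ^ k : Fn) ∘ₗ ev) :=
    tSpace_le_fin fun a b => by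
      have := hV a b
      rw [tFun_eq] at this
      exact this
  exact this hf

theorem BHplus_eq : BHplus = bh.map ev := by
  apply le_antisymm
  · refine Submodule.span_le.2 ?_
    rintro _ ⟨d, a, b, k, h0, h1, rfl⟩
    have h := tP_fin_mem d a b
    rw [tFun_eq]
    obtain rfl | rfl : k = 0 ∨ k = 1 := by omega
    · exact ⟨_, tSpace_le_bh _ h, by funext Z; simp⟩
    · exact ⟨_, dt_mul_mem_bh h, by funext Z; rw [ev_dt_mul, zpow_one]⟩
  · refine Submodule.map_le_iff_le_comap.2 (bh_le fun d f hf => ⟨?_, ?_⟩)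
    · have := nrm_zpow_mul_mem hf 0 (V := BHplus) fun a b =>
        Submodule.subset_span ⟨d, a, b, 0, le_refl _, by norm_num, rfl⟩
      simpa using this
    · have := nrm_zpow_mul_mem hf 1 (V := BHplus) fun a b =>
        Submodule.subset_span ⟨d, a, b, 1, by norm_num, le_refl _, rfl⟩
      have e : ev (dt * f) = fun Z => nrm Z ^ (1 : ℤ) * ev f Z := by
        funext Z; rw [ev_dt_mul, zpow_one]
      rw [Submodule.mem_comap, e]; exact this

/-- Inverting a coefficient of degree d produces N^(-d) times its adjugate version, so the exponents
-d and -d - 1 allowed in `BHminus` match f and `dt * f` in `bh`. -/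
theorem BHminus_eq : BHminus = bh.map evInv := by
  apply le_antisymm
  · refine Submodule.span_le.2 ?_
    rintro _ ⟨d, a, b, k, h0, h1, rfl⟩
    have h := adjS_mem (tP_fin_mem d a b)
    rw [tFun_eq]
    obtain rfl | rfl : k = -d ∨ k = -1 + -d := by omega
    · exact ⟨_, tSpace_le_bh _ h, by funext Z; rw [evInv_eq h, adjS_adjS]⟩
    · refine ⟨_, dt_mul_mem_bh h, ?_⟩
      funext Z
      rw [evInv_dt_mul, evInv_eq h, adjS_adjS, zpow_add₀ (nrm_ne_zero Z), zpow_neg_one, mul_assoc]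
  · refine Submodule.map_le_iff_le_comap.2 (bh_le fun d f hf => ⟨?_, ?_⟩)
    · have := nrm_zpow_mul_mem (adjS_mem hf) (-(d : ℤ)) (V := BHminus) fun a b =>
        Submodule.subset_span ⟨d, a, b, -(d : ℤ), by omega, by omega, rfl⟩
      have e : evInv f = fun Z => nrm Z ^ (-(d : ℤ)) * ev (adjS f) Z := by
        funext Z; rw [evInv_eq hf]
      rw [Submodule.mem_comap, e]; exact this
    · have := nrm_zpow_mul_mem (adjS_mem hf) (-1 + -(d : ℤ)) (V := BHminus) fun a b =>
        Submodule.subset_span ⟨d, a, b, -1 + -(d : ℤ), by omega, by omega, rfl⟩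
      have e : evInv (dt * f) = fun Z => nrm Z ^ (-1 + -(d : ℤ)) * ev (adjS f) Z := by
        funext Z
        rw [evInv_dt_mul, evInv_eq hf, zpow_add₀ (nrm_ne_zero Z), zpow_neg_one, mul_assoc]
      rw [Submodule.mem_comap, e]; exact this

/-! ### Integrals over the sphere -/

theorem nrm_spt (x : Metric.sphere (0 : E4) 1) : nrm (spt x) = 1 := by
  change (quat x.1).det = 1
  rw [det_quat, mem_sphere_zero_iff_norm.1 x.2]; simp

theorem evInv_spt (f : Pol) (x : Metric.sphere (0 : E4) 1) :
    evInv f (spt x) = eval (qv x.1) (adjS f) := by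
  have h : ((spt x)⁻¹).val = (spt x).val.adjugate := by
    rw [Matrix.coe_units_inv, Matrix.inv_def]
    change Ring.inverse (nrm (spt x)) • _ = _
    rw [nrm_spt, Ring.inverse_one, one_smul]
  rw [evInv_apply, h, evM_adjugate]; rfl

theorem sphInt_ev {d d' : ℕ} {f g : Pol} (hf : f ∈ tSpace d) (hg : g ∈ tSpace d') :
    sphInt (ev f) (ev g) * ((d + 1).factorial : ℂ) = 2 * Real.pi ^ 2 * fis (fun _ => 1) f g :=
  sphere_inner hf hg

/-- On the unit sphere N = 1, so the inverse is the adjugate, and the Fischer product does not see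
the adjugate. -/
theorem sphInt_evInv {d d' : ℕ} {f g : Pol} (hf : f ∈ tSpace d) (hg : g ∈ tSpace d') :
    sphInt (evInv f) (evInv g) * ((d + 1).factorial : ℂ) =
      2 * Real.pi ^ 2 * fis (fun _ => 1) f g := by
  rw [← fis_adjS, ← sphere_inner (adjS_mem hf) (adjS_mem hg)]
  simp only [sphInt, evInv_spt]

theorem sphInt_ev_dt (f g : Pol) : sphInt (ev (dt * f)) (ev (dt * g)) = sphInt (ev f) (ev g) := by
  simp only [sphInt, ev_dt_mul, nrm_spt, one_mul]

theorem sphInt_evInv_dt (f g : Pol) :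
    sphInt (evInv (dt * f)) (evInv (dt * g)) = sphInt (evInv f) (evInv g) := by
  simp only [sphInt, evInv_dt_mul, nrm_spt, inv_one, one_mul]

/-! ### The theorem for the two spaces -/

theorem hasInvariantForm_ev (hV : Stable (bh.map ev)) :
    HasInvariantForm (bh.map ev) hV phi1 phi2 := by
  have h : ∀ d (a b : Fin (d + 1)), phi1 d a b = ev (tP a (d - a) b) ∧
      phi2 d a b = ev (dt * tP a (d - a) b) := fun d a b =>
    ⟨tFun_eq d a b, by funext Z; rw [phi2, tFun_eq, ev_dt_mul]⟩
  exact hasInvariantForm_map (τ := id) ev_injective (by funext Z; rw [ev_apply, map_one]) rho_ev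
    (fun _ => id) (fun _ => rfl) (fun d a b => ⟨a, b, h d a b⟩) (fun d a b => ⟨a, b, h d a b⟩)
    (fun _ _ _ _ => sphInt_ev) sphInt_ev_dt hV

theorem hasInvariantForm_evInv (hV : Stable (bh.map evInv)) :
    HasInvariantForm (bh.map evInv) hV phi1t phi2t := by
  have h : ∀ d (a b : Fin (d + 1)), phi1t d a b = evInv (tP b (d - b) a) ∧
      phi2t d a b = evInv (dt * tP b (d - b) a) := fun d a b =>
    ⟨by funext Z; rw [phi1t, tFun_eq]; rfl,
      by funext Z; rw [phi2t, tFun_eq, evInv_dt_mul]; rfl⟩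
  exact hasInvariantForm_map (τ := swapBlocks) evInv_injective
    (by funext Z; rw [evInv_apply, map_one]) rho_evInv
    (fun _ => swapBlocks_mem) swapBlocks_swapBlocks (fun d a b => ⟨b, a, h d a b⟩)
    (fun d a b => ⟨b, a, h d b a⟩) (fun _ _ _ _ => sphInt_evInv) sphInt_evInv_dt hV

theorem I0_le_map {e : Pol →ₗ[ℂ] Fn} (he : e 1 = fun _ => 1) : I0 ≤ bh.map e :=
  Submodule.span_le.2 (by rintro _ rfl; exact ⟨1, one_mem_bh, he⟩)

theorem exists_stable_plus : ∃ hp : Stable BHplus, I0 ≤ BHplus ∧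
    HasInvariantForm BHplus hp phi1 phi2 := by
  rw [BHplus_eq]
  exact ⟨stable_map (τ := id) rho_ev, I0_le_map (by funext Z; rw [ev_apply, map_one]),
    hasInvariantForm_ev _⟩

theorem exists_stable_minus : ∃ hm : Stable BHminus, I0 ≤ BHminus ∧
    HasInvariantForm BHminus hm phi1t phi2t := by
  rw [BHminus_eq]
  exact ⟨stable_map rho_evInv, I0_le_map (by funext Z; rw [evInv_apply, map_one]),
    hasInvariantForm_evInv _⟩

end QuatBH

end

theorem theorem2p3 :
    ∃ (hp : Stable BHplus) (hm : Stable BHminus), I0 ≤ BHplus ∧ I0 ≤ BHminus ∧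
    (∃ H : Sesq BHplus,
      SphereFormula BHplus phi1 phi2 H ∧
      IsHerm H ∧ IsIndefinite H ∧ Preserved (act hp) H ∧
      (∀ f : BHplus, (∀ g, H f g = 0) ↔ f.1 ∈ I0) ∧
      ∃ Q : Sesq (Quo BHplus),
        (∀ f g : BHplus, Q (Submodule.Quotient.mk f) (Submodule.Quotient.mk g) = H f g) ∧
        IsHerm Q ∧ IsIndefinite Q ∧ IsNondeg Q ∧ Preserved (qact hp) Q ∧
        (∀ B : Sesq (Quo BHplus), IsHerm B → Preserved (qact hp) B →
          ∃ c : ℝ, ∀ x y, B x y = c * Q x y)) ∧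
    (¬ ∃ B : Sesq (Quo BHplus), IsHerm B ∧ IsPosDef B ∧ Preserved (qact hp) B) ∧
    (∃ H : Sesq BHminus,
      SphereFormula BHminus phi1t phi2t H ∧
      IsHerm H ∧ IsIndefinite H ∧ Preserved (act hm) H ∧
      (∀ f : BHminus, (∀ g, H f g = 0) ↔ f.1 ∈ I0) ∧
      ∃ Q : Sesq (Quo BHminus),
        (∀ f g : BHminus, Q (Submodule.Quotient.mk f) (Submodule.Quotient.mk g) = H f g) ∧
        IsHerm Q ∧ IsIndefinite Q ∧ IsNondeg Q ∧ Preserved (qact hm) Q ∧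
        (∀ B : Sesq (Quo BHminus), IsHerm B → Preserved (qact hm) B →
          ∃ c : ℝ, ∀ x y, B x y = c * Q x y)) ∧
    (¬ ∃ B : Sesq (Quo BHminus), IsHerm B ∧ IsPosDef B ∧ Preserved (qact hm) B) := by
  obtain ⟨hp, hIp, Hp⟩ := exists_stable_plus
  obtain ⟨hm, hIm, Hm⟩ := exists_stable_minus
  exact ⟨hp, hm, hIp, hIm, Hp.1, Hp.2, Hm.1, Hm.2⟩
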